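/- Let $\Bbbk$ be an algebraically closed field. A $\Bbbk$-linear abelian category is *finite* if its Hom spaces are finite-dimensional, every object has a finite filtration with simple quotients, there are enough projectives, and there are finitely many isomorphism classes of simple objects. Let $(\mathcal C,\otimes,\mathbb 1,c)$ be a braided finite tensor category over $\Bbbk$: a finite $\Bbbk$-linear abelian, rigid, braided monoidal category with $\Bbbk$-bilinear $\otimes$ and $\operatorname{End}(\mathbb 1)=\Bbbk$. Write $X^*$ for the dual of $X$ with $\mathrm{ev}_X:X^*\otimes X\to\mathbb 1$ and $\mathrm{coev}_X:\mathbb 1\to X\otimes X^*$. Let $(\mathcal M,\triangleright)$ be a left $\mathcal C$-module category that is abelian and finite, with $\triangleright$ bilinear on morphisms and $(-\triangleright M)$ exact for every $M\in\mathcal M$. Associativity and unit isomorphisms are suppressed. The *reflective center* $\mathcal E_{\mathcal C}(\mathcal M)$ has as objects the pairs $(M,e^M)$ with $M\in\mathcal M$ and $e^M=\{e^M_X:X\triangleright M\xrightarrow{\sim}X\triangleright M\}_{X\in\mathcal C}$ a natural isomorphism with $$e^M_{X\otimes Y}=(\mathrm{id}_X\triangleright e^M_Y)(c_{Y,X}\triangleright\mathrm{id}_M)(\mathrm{id}_Y\triangleright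 e^M_X)(c_{Y,X}^{-1}\triangleright\mathrm{id}_M),$$ and as morphisms $(M,e^M)\to(N,e^N)$ the $f:M\to N$ with $(\mathrm{id}_X\triangleright f)e^M_X=e^N_X(\mathrm{id}_X\triangleright f)$ for all $X$. The coend $\mathtt C_{\mathcal C}=\int^{X\in\mathcal C}X^*\otimes X$, with canonical morphisms $\iota_X:X^*\otimes X\to\mathtt C_{\mathcal C}$, exists and is an algebra in $\mathcal C$ (the underlying algebra of the coend Hopf algebra) with $$m(\iota_X\otimes\iota_Y)=\iota_{X\otimes Y}(c_{X^*,Y^*}\otimes\mathrm{id}_X\otimes\mathrm{id}_Y)(\mathrm{id}_{X^*}\otimes c_{X,Y^*}\otimes\mathrm{id}_Y),\qquad u=\iota_{\mathbb 1}.$$ Let $\mathtt C_{\mathcal C}\text{-}\mathsf{Mod}(\mathcal M)$ be the Eilenberg–Moore category of the monad $(\mathtt C_{\mathcal C}\triangleright-)$ on $\mathcal M$; its objects are pairs $(M,\xi_M)$ with $\xi_M:\mathtt C_{\mathcal C}\triangleright M\to M$. Then: (a) For each $(M,e^M)\in\mathcal E_{\mathcal C}(\mathcal M)$ there is a unique $\xi_M:\mathtt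 C_{\mathcal C}\triangleright M\to M$ with $$\xi_M(\iota_X\triangleright\mathrm{id}_M)=(\mathrm{ev}_X\triangleright\mathrm{id}_M)(\mathrm{id}_{X^*}\triangleright e^M_X)\quad\text{for all }X\in\mathcal C,$$ and $(M,e^M)\mapsto(M,\xi_M)$, $f\mapsto f$ defines a functor $H_{\mathcal C}:\mathcal E_{\mathcal C}(\mathcal M)\to\mathtt C_{\mathcal C}\text{-}\mathsf{Mod}(\mathcal M)$. (b) $H_{\mathcal C}$ is an equivalence of categories, with quasi-inverse $\widehat H_{\mathcal C}:(M,\xi_M)\mapsto(M,e^M)$, $g\mapsto g$, where $$e^M_X=(\mathrm{id}_X\triangleright\xi_M)(\mathrm{id}_X\otimes\iota_X\triangleright\mathrm{id}_M)(\mathrm{coev}_X\otimes\mathrm{id}_X\triangleright\mathrm{id}_M).$$ -/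

import Mathlib

open CategoryTheory CategoryTheory.Limits CategoryTheory.MonoidalCategory Opposite
open scoped CategoryTheory.MonoidalCategory.MonoidalLeftAction

noncomputable section

namespace ReflectiveEM

universe w v₁ u₁ v₂ u₂ v₃ u₃

/-! ### Finite linear categories, finite tensor categories and their module categories -/

section Finiteness

/-- `X` has a finite filtration whose successive quotients are simple objects. -/
inductive HasFiniteFiltration {A : Type u₁} [Category.{v₁} A] [Abelian A] : A → Prop
  | zero {X : A} (hX : IsZero X) : HasFiniteFiltration X
  | step (S : ShortComplex A) (hS : S.ShortExact) (h₁ : HasFiniteFiltration S.X₁)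
      (h₃ : Simple S.X₃) : HasFiniteFiltration S.X₂

/-- A `k`-linear abelian category is finite: finite-dimensional Hom spaces, objects of finite
length, enough projectives, and finitely many isomorphism classes of simple objects. -/
class IsFiniteCategory (k : Type w) [Field k] (A : Type u₁) [Category.{v₁} A] [Abelian A]
    [Linear k A] : Prop where
  finiteDimensional_hom : ∀ X Y : A, FiniteDimensional k (X ⟶ Y)
  hasFiniteFiltration : ∀ X : A, HasFiniteFiltration X
  enoughProjectives : EnoughProjectives A
  finite_simples : ∃ (n : ℕ) (S : Fin n → A), (∀ i, Simple (S i)) ∧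
    ∀ X : A, Simple X → ∃ i, Nonempty (X ≅ S i)

/-- A rigid monoidal `k`-linear abelian category with `k`-bilinear tensor product is a finite
tensor category if it is finite and `k → End(𝟙)`, `c ↦ c • id`, is bijective. -/
class IsFiniteTensorCategory (k : Type w) [Field k] (C : Type u₁) [Category.{v₁} C] [Abelian C]
    [Linear k C] [MonoidalCategory C] [MonoidalPreadditive C] [MonoidalLinear k C]
    [RigidCategory C] : Prop extends IsFiniteCategory k C where
  bijective_unit : Function.Bijective fun c : k => (c • 𝟙 (𝟙_ C) : 𝟙_ C ⟶ 𝟙_ C)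

/-- A left module category over a finite tensor category: a category with a left action that is
abelian, finite, with `▷` bilinear on morphisms, and `(- ▷ m)` exact for every object `m`. -/
class IsFiniteModuleCategory (k : Type w) [Field k]
    (C : Type u₁) [Category.{v₁} C] [Abelian C] [Linear k C] [MonoidalCategory C]
    (M : Type u₂) [Category.{v₂} M] [Abelian M] [Linear k M] [MonoidalLeftAction C M] : Prop
    extends IsFiniteCategory k M where
  add_actionHomLeft : ∀ {X Y : C} (f g : X ⟶ Y) (m : M), (f + g) ⊵ₗ m = f ⊵ₗ m + g ⊵ₗ m
  smul_actionHomLeft : ∀ (c : k) {X Y : C} (f : X ⟶ Y) (m : M), (c • f) ⊵ₗ m = c • f ⊵ₗ m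
  actionHomRight_add : ∀ (X : C) {m n : M} (f g : m ⟶ n), X ⊴ₗ (f + g) = X ⊴ₗ f + X ⊴ₗ g
  actionHomRight_smul : ∀ (c : k) (X : C) {m n : M} (f : m ⟶ n), X ⊴ₗ (c • f) = c • X ⊴ₗ f
  preservesFiniteLimits : ∀ m : M, PreservesFiniteLimits (MonoidalLeftAction.actionRight C m)
  preservesFiniteColimits : ∀ m : M, PreservesFiniteColimits (MonoidalLeftAction.actionRight C m)

end Finiteness

/-! ### The coend `∫^X X^* ⊗ X` and its algebra structure

The dual `X^*` with `ev : X^* ⊗ X ⟶ 𝟙` and `coev : 𝟙 ⟶ X ⊗ X^*` is Mathlib's right dual. -/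

section Coend

variable {C : Type u₁} [Category.{v₁} C] [MonoidalCategory C] [RightRigidCategory C]

/-- The dual object `X^*`. -/
abbrev dual (X : C) : C := Xᘁ

/-- The evaluation `X^* ⊗ X ⟶ 𝟙`. -/
abbrev ev (X : C) : dual X ⊗ X ⟶ 𝟙_ C := ExactPairing.evaluation X (dual X)

/-- The coevaluation `𝟙 ⟶ X ⊗ X^*`. -/
abbrev coev (X : C) : 𝟙_ C ⟶ X ⊗ dual X := ExactPairing.coevaluation X (dual X)

/-- The dual `f^* : Y^* ⟶ X^*` of a morphism `f : X ⟶ Y`. -/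
abbrev dualMap {X Y : C} (f : X ⟶ Y) : dual Y ⟶ dual X := rightAdjointMate f

/-- The canonical isomorphism `Y^* ⊗ X^* ≅ (X ⊗ Y)^*` between two duals of `X ⊗ Y`. -/
def dualTensorIso (X Y : C) : dual Y ⊗ dual X ≅ dual (X ⊗ Y) :=
  rightDualIso (ExactPairing.tensor (X₁ := X) (X₂ := Y) (Y₁ := dual X) (Y₂ := dual Y))
    (HasRightDual.exact (X := X ⊗ Y))

variable (C) in
/-- The functor `(X, Y) ↦ X^* ⊗ Y`. -/
@[simps]
def dualTensor : Cᵒᵖ ⥤ C ⥤ C where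
  obj X :=
    { obj := fun Y => dual X.unop ⊗ Y
      map := fun g => dual X.unop ◁ g }
  map f :=
    { app := fun Y => dualMap f.unop ▷ Y
      naturality := fun _ _ g => by
        dsimp only
        exact whisker_exchange (dualMap f.unop) g }
  map_id X := by
    ext Y
    simp [dualMap]
  map_comp f g := by
    ext Y
    simp [dualMap, comp_rightAdjointMate]

/-- The morphism `(c_{X^*,Y^*} ⊗ id ⊗ id) (id ⊗ c_{X,Y^*} ⊗ id)` from `X^* ⊗ X ⊗ Y^* ⊗ Y` to
`Y^* ⊗ X^* ⊗ X ⊗ Y ≅ (X ⊗ Y)^* ⊗ (X ⊗ Y)`. -/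
def shuffle [BraidedCategory C] (X Y : C) :
    (dual X ⊗ X) ⊗ (dual Y ⊗ Y) ⟶ dual (X ⊗ Y) ⊗ (X ⊗ Y) :=
  (α_ (dual X) X (dual Y ⊗ Y)).hom ≫ dual X ◁ (α_ X (dual Y) Y).inv ≫
    dual X ◁ ((β_ X (dual Y)).hom ▷ Y) ≫ dual X ◁ (α_ (dual Y) X Y).hom ≫
    (α_ (dual X) (dual Y) (X ⊗ Y)).inv ≫ (β_ (dual X) (dual Y)).hom ▷ (X ⊗ Y) ≫
    (dualTensorIso X Y).hom ▷ (X ⊗ Y)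

/-- The component `X^* ⊗ X ⟶ K` at `X` of a dinatural transformation to a constant functor. -/
abbrev cowedgeι (K : Cowedge (dualTensor C)) (X : C) : dual X ⊗ X ⟶ K.pt :=
  Multicofork.π K X

variable (C) in
/-- A coend `C_C = ∫^X X^* ⊗ X` with canonical morphisms `ι_X : X^* ⊗ X ⟶ C_C`, together with its
canonical algebra structure: `m (ι_X ⊗ ι_Y) = ι_{X ⊗ Y} (c_{X^*,Y^*} ⊗ id) (id ⊗ c_{X,Y^*} ⊗ id)`
and `u = ι_𝟙`, where `𝟙^* ⊗ 𝟙` is identified with `𝟙` along the isomorphism `ev_𝟙`. -/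
structure CoendAlgebra [BraidedCategory C] where
  cowedge : Cowedge (dualTensor C)
  isColimit : IsColimit cowedge
  monObj : MonObj cowedge.pt
  ev_unit_comp_one : ev (𝟙_ C) ≫ monObj.one = cowedgeι cowedge (𝟙_ C)
  tensorHom_comp_mul : ∀ X Y : C,
    (cowedgeι cowedge X ⊗ₘ cowedgeι cowedge Y) ≫ monObj.mul =
      shuffle X Y ≫ cowedgeι cowedge (X ⊗ Y)

namespace CoendAlgebra

variable [BraidedCategory C] (A : CoendAlgebra C)

/-- The coend object. -/
abbrev pt : C := A.cowedge.pt

/-- The canonical morphisms `X^* ⊗ X ⟶ C_C`. -/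
abbrev ι (X : C) : dual X ⊗ X ⟶ A.pt := cowedgeι A.cowedge X

instance : MonObj A.pt := A.monObj

end CoendAlgebra

end Coend

/-! ### Eilenberg–Moore categories -/

section EilenbergMoore

variable {C : Type u₁} [Category.{v₁} C] [MonoidalCategory C]
variable (M : Type u₂) [Category.{v₂} M] [MonoidalLeftAction C M]

/-- The monad `(A ▷ -)` on a left module category attached to an algebra `A`. Its Eilenberg–Moore
category is `A-Mod(M)`. -/
@[simps]
def actionMonad (A : C) [MonObj A] : Monad M where
  obj m := A ⊙ₗ m
  map f := A ⊴ₗ f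
  η :=
    { app := fun m => (λₗ[C] m).inv ≫ (MonObj.one : 𝟙_ C ⟶ A) ⊵ₗ m
      naturality := fun m n f => by
        simp [← MonoidalLeftAction.action_exchange] }
  μ :=
    { app := fun m => (αₗ A A m).inv ≫ (MonObj.mul : A ⊗ A ⟶ A) ⊵ₗ m
      naturality := fun m n f => by
        simp [← MonoidalLeftAction.action_exchange] }
  assoc m := by
    have h := congrArg (fun t => t ⊵ₗ m) (MonObj.mul_assoc A)
    simp only [MonoidalLeftAction.comp_actionHomLeft,
      MonoidalLeftAction.whiskerLeft_actionHomLeft, Category.assoc] at h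
    rw [← cancel_epi ((αₗ (A ⊗ A) A m).hom ≫ (αₗ A A (A ⊙ₗ m)).hom)]
    have h' := MonoidalLeftAction.associator_actionHom_assoc A A A m
      (A ⊴ₗ (αₗ A A m).inv ≫ A ⊴ₗ (MonObj.mul : A ⊗ A ⟶ A) ⊵ₗ m ≫
        (αₗ A A m).inv ≫ (MonObj.mul : A ⊗ A ⟶ A) ⊵ₗ m)
    simp only [MonoidalLeftAction.actionHomRight_hom_inv_assoc] at h'
    simp [h, h']
  left_unit m := by
    have h := congrArg (fun t => t ⊵ₗ m) (MonObj.one_mul A)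
    simp only [MonoidalLeftAction.comp_actionHomLeft,
      MonoidalLeftAction.leftUnitor_actionHom] at h
    simp [h]
  right_unit m := by
    have h := congrArg (fun t => t ⊵ₗ m) (MonObj.mul_one A)
    simp only [MonoidalLeftAction.comp_actionHomLeft, Category.assoc,
      MonoidalLeftAction.whiskerLeft_actionHomLeft,
      MonoidalLeftAction.rightUnitor_actionHom, Iso.cancel_iso_hom_left] at h
    simp [h]

variable {M}

/-- A functor `F : D ⥤ M` together with actions of `T` on the objects `F d`, for which the
morphisms `F f` are `T`-linear, gives the functor `d ↦ (F d, ξ_d)`, `f ↦ F f` to the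
Eilenberg–Moore category of `T`. -/
@[simps]
def liftEM {D : Type u₃} [Category.{v₃} D] (F : D ⥤ M) (T : Monad M)
    (ξ : ∀ d, T.obj (F.obj d) ⟶ F.obj d)
    (unit : ∀ d, T.η.app (F.obj d) ≫ ξ d = 𝟙 (F.obj d))
    (assoc : ∀ d, T.μ.app (F.obj d) ≫ ξ d = T.map (ξ d) ≫ ξ d)
    (linear : ∀ {d d' : D} (f : d ⟶ d'), T.map (F.map f) ≫ ξ d' = ξ d ≫ F.map f) :
    D ⥤ T.Algebra where
  obj d := { A := F.obj d, a := ξ d, unit := unit d, assoc := assoc d }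
  map f := { f := F.map f, h := linear f }

end EilenbergMoore

/-! ### Reflective centers -/

section Center

variable (C : Type u₁) [Category.{v₁} C] [MonoidalCategory C] [BraidedCategory C]
variable {M : Type u₂} [Category.{v₂} M] [MonoidalLeftAction C M]

/-- A reflection on `m`: a natural isomorphism `e_X : X ▷ m ≅ X ▷ m` such that
`e_{X ⊗ Y} = (id_X ▷ e_Y) (c_{Y,X} ▷ id) (id_Y ▷ e_X) (c_{Y,X}⁻¹ ▷ id)`. -/
structure Reflection (m : M) where
  e : ∀ X : C, X ⊙ₗ m ≅ X ⊙ₗ m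
  naturality : ∀ {X Y : C} (f : X ⟶ Y), f ⊵ₗ m ≫ (e Y).hom = (e X).hom ≫ f ⊵ₗ m
  tensor : ∀ X Y : C, (e (X ⊗ Y)).hom =
    (β_ Y X).inv ⊵ₗ m ≫ (αₗ Y X m).hom ≫ Y ⊴ₗ (e X).hom ≫ (αₗ Y X m).inv ≫
      (β_ Y X).hom ⊵ₗ m ≫ (αₗ X Y m).hom ≫ X ⊴ₗ (e Y).hom ≫ (αₗ X Y m).inv

variable (M) in
/-- Objects `(m, e^m)` of the reflective center of the left `C`-module category `M`. -/
structure ReflectiveCenter where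
  obj : M
  refl : Reflection C obj

namespace ReflectiveCenter

variable {C}

/-- Morphisms of the reflective center: morphisms of `M` that commute with the reflections. -/
@[ext]
structure Hom (E E' : ReflectiveCenter C M) where
  hom : E.obj ⟶ E'.obj
  comm : ∀ X : C, (E.refl.e X).hom ≫ X ⊴ₗ hom = X ⊴ₗ hom ≫ (E'.refl.e X).hom

instance : Category (ReflectiveCenter C M) where
  Hom E E' := Hom E E'
  id E := { hom := 𝟙 E.obj, comm := by simp }
  comp f g :=
    { hom := f.hom ≫ g.hom
      comm := fun X => by
        rw [MonoidalLeftAction.actionHomRight_comp, ← Category.assoc, f.comm, Category.assoc,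
          g.comm, Category.assoc] }

variable (C M) in
/-- The forgetful functor `(m, e^m) ↦ m`. -/
@[simps]
def forget : ReflectiveCenter C M ⥤ M where
  obj E := E.obj
  map f := f.hom

/-- A functor `F : D ⥤ M` together with reflections on the objects `F d`, with which the morphisms
`F f` commute, gives the functor `d ↦ (F d, e_d)`, `f ↦ F f` to the reflective center. -/
@[simps]
def lift {D : Type u₃} [Category.{v₃} D] (F : D ⥤ M) (e : ∀ d, Reflection C (F.obj d))
    (comm : ∀ {d d' : D} (f : d ⟶ d') (X : C),
      ((e d).e X).hom ≫ X ⊴ₗ F.map f = X ⊴ₗ F.map f ≫ ((e d').e X).hom) :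
    D ⥤ ReflectiveCenter C M where
  obj d := { obj := F.obj d, refl := e d }
  map f := { hom := F.map f, comm := comm f }
  map_id d := Hom.ext (F.map_id d)
  map_comp f g := Hom.ext (F.map_comp f g)

end ReflectiveCenter

end Center

/-! ### From reflections to actions of the coend algebra and back -/

section Comparison

variable {C : Type u₁} [Category.{v₁} C] [MonoidalCategory C] [RightRigidCategory C]
  [BraidedCategory C] (A : CoendAlgebra C)
variable {M : Type u₂} [Category.{v₂} M] [MonoidalLeftAction C M]

/-- `ξ : C_C ▷ m ⟶ m` is induced by the reflection `e` on `m`: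
`ξ (ι_X ▷ id) = (ev_X ▷ id) (id_{X^*} ▷ e_X)` for all `X`. -/
def IsInducedAction {m : M} (r : Reflection C m) (ξ : A.pt ⊙ₗ m ⟶ m) : Prop :=
  ∀ X : C, A.ι X ⊵ₗ m ≫ ξ =
    (αₗ (dual X) X m).hom ≫ dual X ⊴ₗ (r.e X).hom ≫ (αₗ (dual X) X m).inv ≫
      ev X ⊵ₗ m ≫ (λₗ[C] m).hom

/-- The endomorphism `(id_X ▷ ξ) (id_X ⊗ ι_X ▷ id) (coev_X ⊗ id_X ▷ id)` of `X ▷ m` attached to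
`ξ : C_C ▷ m ⟶ m`. -/
def inducedReflection {m : M} (ξ : A.pt ⊙ₗ m ⟶ m) (X : C) : X ⊙ₗ m ⟶ X ⊙ₗ m :=
  (λₗ[C] (X ⊙ₗ m)).inv ≫ coev X ⊵ₗ (X ⊙ₗ m) ≫ (αₗ X (dual X) (X ⊙ₗ m)).hom ≫
    X ⊴ₗ (αₗ (dual X) X m).inv ≫ X ⊴ₗ (A.ι X ⊵ₗ m) ≫ X ⊴ₗ ξ

end Comparison

end ReflectiveEM

end

open ReflectiveEM

noncomputable section

namespace ReflectiveEM

universe w v₁ u₁ v₂ u₂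

-- A finite category has a projective generator `P`, and by dinaturality and finite-dimensionality
-- of `End(P)` the coend `K = ∫ X^* ⊗ X` is the cokernel of finitely many relations on `P^* ⊗ P`.
-- Hence every right exact functor preserves it, in particular `(- ▷ m)`. Transposing along duality,
-- morphisms `K ▷ m ⟶ n` correspond bijectively to natural families `X ▷ m ⟶ X ▷ n`, by composing
-- with the canonical coaction `X ⟶ X ⊗ K` (`coactionHom_injective`, `exists_coactionHom_eq`). Both
-- formulas of the theorem describe this one bijection (`isInducedAction_iff`,
-- `inducedReflection_eq`).
--
-- It remains to match the axioms. Through coactions, the product of `K` says that coacting on `X ⊗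
-- Y` is coacting on `X`, moving `K` under `Y`, coacting on `Y` and multiplying
-- (`isMultiplicative_iff`). Applying the bijection in `Y` and then in `X` turns the associativity
-- axiom of an action `ξ` into the tensor axiom of its family `e`; the unit axiom becomes `e_𝟙 =
-- id`. A reflection has `e_𝟙 = id` because `e_{𝟙 ⊗ 𝟙}` is an invertible idempotent. Conversely, the
-- tensor axiom at `(X, X^*)` gives `e_X` a one-sided inverse, which is two-sided because `End(X ▷
-- m)` is finite-dimensional.
--
-- The algebra `K` itself comes from the same bijection for `C` acting on itself: it yields the
-- product, and its uniqueness half yields the algebra axioms.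

attribute [local instance] Abelian.hasFiniteBiproducts

/-! ### Projective generators of finite categories -/

section Generator

variable {A : Type u₁} [Category.{v₁} A] [Abelian A]

/-- Every object of finite length is a quotient of a finite direct sum of copies of `P`, provided
every simple object is a quotient of the projective object `P`. -/
theorem HasFiniteFiltration.exists_epi_biproduct {P : A} [Projective P]
    (hP : ∀ S : A, Simple S → ∃ p : P ⟶ S, Epi p) {X : A} (hX : HasFiniteFiltration X) :
    ∃ (n : ℕ) (π : (⨁ fun _ : Fin n => P) ⟶ X), Epi π := by
  induction hX with
  | zero hX => exact ⟨0, 0, ⟨fun _ _ _ => hX.eq_of_src _ _⟩⟩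
  | step S hS _ h₃ ih =>
    obtain ⟨n, π, hπ⟩ := ih
    obtain ⟨p, hp⟩ := hP S.X₃ h₃
    have := hS.epi_g
    -- Copy `0` of `P` lifts the cover of the simple quotient; the other `n` copies cover the
    -- subobject.
    refine ⟨n + 1, biproduct.desc (Fin.cons (Projective.factorThru p S.g)
      fun i => biproduct.ι (fun _ : Fin n => P) i ≫ π ≫ S.f), ?_⟩
    refine Preadditive.epi_of_cancel_zero _ fun {Z} g hg => ?_
    have h₀ : Projective.factorThru p S.g ≫ g = 0 := by
      have := biproduct.ι (fun _ : Fin (n + 1) => P) 0 ≫= hg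
      simpa using this
    have h₁ : S.f ≫ g = 0 := by
      rw [← cancel_epi π, comp_zero]
      refine biproduct.hom_ext' _ _ fun i => ?_
      have := biproduct.ι (fun _ : Fin (n + 1) => P) i.succ ≫= hg
      simpa using this
    obtain ⟨t, ht⟩ : ∃ t, S.g ≫ t = g := ⟨hS.exact.desc g h₁, hS.exact.g_desc g h₁⟩
    have h₂ : p ≫ t = 0 := by
      rw [← Projective.factorThru_comp p S.g, Category.assoc, ht, h₀]
    rw [← ht, (cancel_epi p).1 (h₂.trans comp_zero.symm), comp_zero]

/-- A projective object of which every object is a quotient of a finite direct power. -/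
structure IsFiniteGenerator (P : A) : Prop where
  projective : Projective P
  exists_epi : ∀ X : A, ∃ (n : ℕ) (π : (⨁ fun _ : Fin n => P) ⟶ X), Epi π

theorem exists_isFiniteGenerator (k : Type w) [Field k] [Linear k A] [IsFiniteCategory k A] :
    ∃ P : A, IsFiniteGenerator P := by
  obtain ⟨n, S, -, hS⟩ := IsFiniteCategory.finite_simples (k := k) (A := A)
  have := IsFiniteCategory.enoughProjectives (k := k) (A := A)
  have hP : Projective (⨁ fun i : Fin n => Projective.over (S i)) :=
    ⟨fun f e _ => ⟨biproduct.desc fun i => Projective.factorThru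
      (biproduct.ι (fun i : Fin n => Projective.over (S i)) i ≫ f) e,
      biproduct.hom_ext' _ _ fun i => by simp⟩⟩
  refine ⟨_, hP, fun X => (IsFiniteCategory.hasFiniteFiltration (k := k) X).exists_epi_biproduct
    fun T hT => ?_⟩
  obtain ⟨i, ⟨e⟩⟩ := hS T hT
  exact ⟨biproduct.π _ i ≫ Projective.π (S i) ≫ e.inv, inferInstance⟩

/-- Morphisms out of `F X`, for `F` right exact, are detected by the maps `F p` with `p : P ⟶ X`. -/
theorem IsFiniteGenerator.map_hom_ext {P : A} (hP : IsFiniteGenerator P)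
    {D : Type u₂} [Category.{v₂} D] [Preadditive D] (F : A ⥤ D) [F.Additive]
    [F.PreservesEpimorphisms] {X : A} {Z : D} {f g : F.obj X ⟶ Z}
    (h : ∀ p : P ⟶ X, F.map p ≫ f = F.map p ≫ g) : f = g := by
  obtain ⟨n, π, hπ⟩ := hP.exists_epi X
  have hπ' : π = ∑ j, biproduct.π (fun _ : Fin n => P) j ≫
      biproduct.ι (fun _ : Fin n => P) j ≫ π := by
    simp_rw [← Category.assoc, ← Preadditive.sum_comp, biproduct.total, Category.id_comp]
  rw [← cancel_epi (F.map π), hπ', F.map_sum]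
  simp only [Preadditive.sum_comp]
  refine Finset.sum_congr rfl fun j _ => ?_
  rw [F.map_comp, Category.assoc, h, Category.assoc]

/-- An epimorphism is the cokernel of its kernel, and right exactness carries this to `F`. -/
theorem exists_map_desc_of_epi {D : Type u₂} [Category.{v₂} D] [Abelian D] (F : A ⥤ D) [F.Additive]
    [PreservesFiniteColimits F] {X Y : A} (π : X ⟶ Y) [Epi π] {W : D} (t : F.obj X ⟶ W)
    (ht : F.map (kernel.ι π) ≫ t = 0) : ∃ g : F.obj Y ⟶ W, F.map π ≫ g = t := by
  have hS : ((ShortComplex.mk _ π (kernel.condition π)).map F).Exact :=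
    (ShortComplex.exact_kernel π).map_of_epi_of_preservesCokernel F ‹Epi π› inferInstance
  have : Epi ((ShortComplex.mk _ π (kernel.condition π)).map F).g :=
    inferInstanceAs (Epi (F.map π))
  exact ⟨hS.desc t ht, hS.g_desc t ht⟩

end Generator

/-! ### Duality of morphisms, cowedges and relations -/

section Dual

variable {C : Type u₁} [Category.{v₁} C] [MonoidalCategory C] [RightRigidCategory C]

theorem dualMap_comp {X Y Z : C} (f : X ⟶ Y) (g : Y ⟶ Z) :
    dualMap (f ≫ g) = dualMap g ≫ dualMap f := comp_rightAdjointMate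

instance (X : C) : (tensorLeft (dual X)).IsLeftAdjoint :=
  (tensorLeftAdjunction X (dual X)).isLeftAdjoint

instance (X : C) : (tensorRight X).IsLeftAdjoint :=
  (tensorRightAdjunction X (dual X)).isLeftAdjoint

variable [Preadditive C] [MonoidalPreadditive C]

theorem dualMap_add {X Y : C} (f g : X ⟶ Y) : dualMap (f + g) = dualMap f + dualMap g := by
  simp [dualMap, rightAdjointMate]

variable (C) in
/-- Dualising morphisms, as an additive map. -/
def dualMapAddHom (X Y : C) : (X ⟶ Y) →+ (dual Y ⟶ dual X) :=
  AddMonoidHom.mk' dualMap dualMap_add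

theorem dualMap_zero (X Y : C) : dualMap (0 : X ⟶ Y) = 0 := (dualMapAddHom C X Y).map_zero

theorem dualMap_sum {X Y : C} {ι : Type*} (s : Finset ι) (f : ι → (X ⟶ Y)) :
    dualMap (∑ i ∈ s, f i) = ∑ i ∈ s, dualMap (f i) := map_sum (dualMapAddHom C X Y) f s

theorem dualMap_smul {k : Type w} [Field k] [Linear k C] [MonoidalLinear k C] {X Y : C} (c : k)
    (f : X ⟶ Y) : dualMap (c • f) = c • dualMap f := by
  simp [dualMap, rightAdjointMate]

end Dual

section Cowedge

variable {C : Type u₁} [Category.{v₁} C] [MonoidalCategory C] [RightRigidCategory C]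

theorem cowedge_condition (K : Cowedge (dualTensor C)) {X Y : C} (f : X ⟶ Y) :
    dualMap f ▷ X ≫ cowedgeι K X = dual Y ◁ f ≫ cowedgeι K Y :=
  Cowedge.condition K f

theorem cowedge_hom_ext {K : Cowedge (dualTensor C)} (hK : IsColimit K) {W : C} {f g : K.pt ⟶ W}
    (h : ∀ X, cowedgeι K X ≫ f = cowedgeι K X ≫ g) : f = g :=
  Cowedge.IsColimit.hom_ext hK h

theorem exists_cowedge_desc {K : Cowedge (dualTensor C)} (hK : IsColimit K) {W : C}
    (f : ∀ X : C, dual X ⊗ X ⟶ W)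
    (hf : ∀ ⦃X Y : C⦄ (u : X ⟶ Y), dualMap u ▷ X ≫ f X = dual Y ◁ u ≫ f Y) :
    ∃ g : K.pt ⟶ W, ∀ X, cowedgeι K X ≫ g = f X :=
  ⟨Cowedge.IsColimit.desc hK f hf, Cowedge.IsColimit.π_desc hK f hf⟩

end Cowedge

section Relations

variable {C : Type u₁} [Category.{v₁} C] [Abelian C] [MonoidalCategory C] [RightRigidCategory C]

/-- The relations that define the coend as a quotient of `P^* ⊗ P`. -/
def relations (P : C) {I : Type} [Finite I] (b : I → (P ⟶ P)) :
    (⨁ fun _ : I => dual P ⊗ P) ⟶ dual P ⊗ P :=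
  biproduct.desc fun i => dualMap (b i) ▷ P - dual P ◁ b i

/-- Stated for an additive `F` so that it serves both to construct the coend (`F` the identity) and
to show that right exact functors preserve it. -/
theorem relations_comp_eq_zero_iff {P : C} {I : Type} [Finite I] (b : I → (P ⟶ P))
    {D : Type u₂} [Category.{v₂} D] [Preadditive D] (F : C ⥤ D) [F.Additive]
    {W : D} (f : F.obj (dual P ⊗ P) ⟶ W) :
    F.map (relations P b) ≫ f = 0 ↔
      ∀ i, F.map (dualMap (b i) ▷ P) ≫ f = F.map (dual P ◁ b i) ≫ f := by
  have := Fintype.ofFinite I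
  constructor
  · intro h i
    have := F.map (biproduct.ι (fun _ : I => dual P ⊗ P) i) ≫= h
    rw [← F.map_comp_assoc, relations, biproduct.ι_desc, comp_zero, F.map_sub,
      Preadditive.sub_comp, sub_eq_zero] at this
    exact this
  · intro h
    have hr : relations P b = ∑ i, biproduct.π (fun _ : I => dual P ⊗ P) i ≫
        (dualMap (b i) ▷ P - dual P ◁ b i) := by
      rw [relations, biproduct.desc_eq]
    rw [hr, F.map_sum, Preadditive.sum_comp]
    refine Finset.sum_eq_zero fun i _ => ?_
    rw [F.map_comp, Category.assoc, F.map_sub, Preadditive.sub_comp, h, sub_self, comp_zero]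

end Relations

/-! ### The coend as a finite colimit -/

section CoendExists

variable {C : Type u₁} [Category.{v₁} C] [Abelian C] [MonoidalCategory C]
  [MonoidalPreadditive C] [RightRigidCategory C]

instance (X : C) : (tensorLeft X).Additive where

theorem IsFiniteGenerator.dual_tensor_hom_ext {P : C} (hP : IsFiniteGenerator P) {X Y W : C}
    {f g : dual X ⊗ Y ⟶ W} (h : ∀ p : P ⟶ Y, dual X ◁ p ≫ f = dual X ◁ p ≫ g) : f = g :=
  hP.map_hom_ext (tensorLeft (dual X)) h

/-- A morphism out of `P^* ⊗ P` that is dinatural for endomorphisms of the generator `P` extends to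
`X^* ⊗ X`. -/
theorem IsFiniteGenerator.exists_extension {P : C} (hP : IsFiniteGenerator P) {W : C}
    (f : dual P ⊗ P ⟶ W) (hf : ∀ φ : P ⟶ P, dualMap φ ▷ P ≫ f = dual P ◁ φ ≫ f) (X : C) :
    ∃ g : dual X ⊗ X ⟶ W, ∀ p : P ⟶ X, dual X ◁ p ≫ g = dualMap p ▷ P ≫ f := by
  obtain ⟨n, π, hπ⟩ := hP.exists_epi X
  have := hP.projective
  -- The extension is forced on each copy of `P` in a cover of `X`. By `ht` below, `t` after `q`
  -- depends only on `q ≫ π`, so `t` kills the kernel of `π` and descends.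
  let t : dual X ⊗ (⨁ fun _ : Fin n => P) ⟶ W := ∑ j, dual X ◁ biproduct.π (fun _ : Fin n => P) j ≫
    dualMap (biproduct.ι (fun _ : Fin n => P) j ≫ π) ▷ P ≫ f
  have ht : ∀ q : P ⟶ (⨁ fun _ : Fin n => P), dual X ◁ q ≫ t = dualMap (q ≫ π) ▷ P ≫ f := by
    intro q
    have hq : q ≫ π = ∑ j, (q ≫ biproduct.π (fun _ : Fin n => P) j) ≫
        biproduct.ι (fun _ : Fin n => P) j ≫ π := by
      conv_lhs => rw [← Category.comp_id q, ← biproduct.total]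
      simp only [Preadditive.comp_sum, Preadditive.sum_comp, Category.assoc]
    rw [hq, dualMap_sum, sum_whiskerRight, Preadditive.sum_comp, Preadditive.comp_sum]
    refine Finset.sum_congr rfl fun j _ => ?_
    -- The `j`-th component of `q` is an endomorphism of `P`, so the hypothesis on `f` applies to
    -- it.
    rw [dualMap_comp (q ≫ _), comp_whiskerRight, Category.assoc, hf, whiskerLeft_comp_assoc,
      ← whisker_exchange_assoc, ← whisker_exchange_assoc]
  obtain ⟨g, hg⟩ := exists_map_desc_of_epi (tensorLeft (dual X)) π t
    (hP.dual_tensor_hom_ext fun p => by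
      change dual X ◁ p ≫ dual X ◁ kernel.ι π ≫ t = dual X ◁ p ≫ 0
      rw [← whiskerLeft_comp_assoc, ht, Category.assoc, kernel.condition, comp_zero, dualMap_zero,
        MonoidalPreadditive.zero_whiskerRight, zero_comp, comp_zero])
  replace hg : dual X ◁ π ≫ g = t := hg
  refine ⟨g, fun p => ?_⟩
  rw [← Projective.factorThru_comp p π, whiskerLeft_comp_assoc, hg, ht]

/-- Dinaturality along `p : P ⟶ X` makes the component at `X`, restricted along `p`, factor through
the one at `P`, and such `p` detect morphisms out of `X^* ⊗ X`. -/
theorem IsFiniteGenerator.epi_cowedgeι {P : C} (hP : IsFiniteGenerator P)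
    {K : Cowedge (dualTensor C)} (hK : IsColimit K) : Epi (cowedgeι K P) := by
  refine ⟨fun u v huv => cowedge_hom_ext hK fun X => hP.dual_tensor_hom_ext fun p => ?_⟩
  rw [← Category.assoc, ← Category.assoc, ← cowedge_condition, Category.assoc, Category.assoc,
    huv]

theorem map_cowedge_hom_ext (k : Type w) [Field k] [Linear k C] [IsFiniteCategory k C]
    {K : Cowedge (dualTensor C)} (hK : IsColimit K) {D : Type u₂} [Category.{v₂} D] (F : C ⥤ D)
    [F.PreservesEpimorphisms] {W : D} {f g : F.obj K.pt ⟶ W}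
    (h : ∀ X, F.map (cowedgeι K X) ≫ f = F.map (cowedgeι K X) ≫ g) : f = g := by
  obtain ⟨P, hP⟩ := exists_isFiniteGenerator (A := C) k
  have := hP.epi_cowedgeι hK
  rw [← cancel_epi (F.map (cowedgeι K P)), h]

variable (k : Type w) [Field k] [Linear k C] [MonoidalLinear k C]

theorem dinatural_of_basis {P W : C} {I : Type} [Finite I] (b : Module.Basis I k (P ⟶ P))
    (f : dual P ⊗ P ⟶ W) (h : ∀ i, dualMap (b i) ▷ P ≫ f = dual P ◁ b i ≫ f) (φ : P ⟶ P) :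
    dualMap φ ▷ P ≫ f = dual P ◁ φ ≫ f := by
  have := Fintype.ofFinite I
  rw [← b.sum_repr φ, dualMap_sum, sum_whiskerRight, whiskerLeft_sum, Preadditive.sum_comp,
    Preadditive.sum_comp]
  refine Finset.sum_congr rfl fun i _ => ?_
  rw [dualMap_smul, MonoidalLinear.smul_whiskerRight, MonoidalLinear.whiskerLeft_smul,
    Linear.smul_comp, Linear.smul_comp, h]

/-- A morphism out of `P^* ⊗ P` that is dinatural for endomorphisms of the generator `P` extends to
a dinatural family of morphisms out of all `X^* ⊗ X`. -/
theorem IsFiniteGenerator.exists_dinatural {P : C} (hP : IsFiniteGenerator P) {W : C}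
    (f : dual P ⊗ P ⟶ W) (hf : ∀ φ : P ⟶ P, dualMap φ ▷ P ≫ f = dual P ◁ φ ≫ f) :
    ∃ g : ∀ X : C, dual X ⊗ X ⟶ W, g P = f ∧
      ∀ ⦃X Y : C⦄ (u : X ⟶ Y), dualMap u ▷ X ≫ g X = dual Y ◁ u ≫ g Y := by
  choose g hg using hP.exists_extension f hf
  refine ⟨g, ?_, fun X Y u => hP.dual_tensor_hom_ext fun p => ?_⟩
  · have := hg P (𝟙 P)
    simpa [dualMap] using this
  · rw [whisker_exchange_assoc, hg, ← whiskerLeft_comp_assoc, hg, dualMap_comp,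
      comp_whiskerRight_assoc]

variable (C) in
/-- The coend `∫^X X^* ⊗ X` exists. -/
theorem exists_isColimit_cowedge [IsFiniteCategory k C] :
    ∃ K : Cowedge (dualTensor C), Nonempty (IsColimit K) := by
  obtain ⟨P, hP⟩ := exists_isFiniteGenerator (A := C) k
  have := IsFiniteCategory.finiteDimensional_hom (k := k) P P
  let b := Module.finBasis k (P ⟶ P)
  -- The coend is this cokernel; its projection satisfies the relations for a basis of `End(P)`,
  -- hence for all endomorphisms, and so extends to a dinatural family.
  let f := cokernel.π (relations P b)
  obtain ⟨g, hgP, hg⟩ := hP.exists_dinatural f (dinatural_of_basis k b f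
    ((relations_comp_eq_zero_iff b (𝟭 C) f).1 (cokernel.condition _)))
  let d (K : Cowedge (dualTensor C)) : cokernel (relations P b) ⟶ K.pt :=
    cokernel.desc _ (cowedgeι K P)
      ((relations_comp_eq_zero_iff b (𝟭 C) _).2 fun i => cowedge_condition K (b i))
  have hd (K) : g P ≫ d K = cowedgeι K P := hgP ▸ cokernel.π_desc _ _ _
  refine ⟨Cowedge.mk _ g hg, ⟨Multicofork.IsColimit.mk _ d
    (fun K (X : C) => hP.dual_tensor_hom_ext fun p : P ⟶ X => ?_) (fun K m hm => ?_)⟩⟩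
  · change dual X ◁ p ≫ g X ≫ d K = dual X ◁ p ≫ cowedgeι K X
    rw [← cowedge_condition, ← hd, ← Category.assoc, ← hg, Category.assoc]
  · have h : g P ≫ m = g P ≫ d K := (hm P).trans (hd K).symm
    rw [hgP] at h
    exact (cancel_epi (cokernel.π (relations P b))).1 h

/-- Right exact functors preserve the coend. -/
theorem exists_map_cowedge_desc [IsFiniteCategory k C] {K : Cowedge (dualTensor C)}
    (hK : IsColimit K) {D : Type u₂} [Category.{v₂} D] [Abelian D] (F : C ⥤ D) [F.Additive]
    [PreservesFiniteColimits F] {W : D} (f : ∀ X : C, F.obj (dual X ⊗ X) ⟶ W)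
    (hf : ∀ ⦃X Y : C⦄ (u : X ⟶ Y), F.map (dualMap u ▷ X) ≫ f X = F.map (dual Y ◁ u) ≫ f Y) :
    ∃ g : F.obj K.pt ⟶ W, ∀ X, F.map (cowedgeι K X) ≫ g = f X := by
  obtain ⟨P, hP⟩ := exists_isFiniteGenerator (A := C) k
  have := IsFiniteCategory.finiteDimensional_hom (k := k) P P
  let b := Module.finBasis k (P ⟶ P)
  have hr : relations P b ≫ cowedgeι K P = 0 :=
    (relations_comp_eq_zero_iff b (𝟭 C) _).2 fun i => cowedge_condition K (b i)
  have := hP.epi_cowedgeι hK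
  -- Any coend is a cokernel of the same finite family of relations, and `F` preserves cokernels.
  have hcoker : IsColimit (CokernelCofork.ofπ (cowedgeι K P) hr) := by
    refine CokernelCofork.IsColimit.ofπ' _ _ fun {W} t ht => Classical.choice ?_
    obtain ⟨g, hgP, hg⟩ := hP.exists_dinatural t (dinatural_of_basis k b t
      ((relations_comp_eq_zero_iff b (𝟭 C) t).1 ht))
    obtain ⟨l, hl⟩ := exists_cowedge_desc hK g hg
    exact ⟨l, (hl P).trans hgP⟩
  obtain ⟨g, hg⟩ : ∃ g : F.obj K.pt ⟶ W, F.map (cowedgeι K P) ≫ g = f P := by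
    obtain ⟨g, hg⟩ := CokernelCofork.IsColimit.desc' (CokernelCofork.mapIsColimit _ hcoker F) (f P)
      ((relations_comp_eq_zero_iff b F _).2 fun i => hf (b i))
    exact ⟨g, hg⟩
  refine ⟨g, fun X => hP.map_hom_ext (tensorLeft (dual X) ⋙ F) fun p => ?_⟩
  change F.map (dual X ◁ p) ≫ _ = F.map (dual X ◁ p) ≫ _
  rw [← hf, ← hg, ← F.map_comp_assoc, ← F.map_comp_assoc, cowedge_condition]

end CoendExists

/-! ### Coherence of module categories -/

section ActionCoherence

open MonoidalLeftAction

variable {C : Type u₁} [Category.{v₁} C] [MonoidalCategory C]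
variable {M : Type u₂} [Category.{v₂} M] [MonoidalLeftAction C M]

/-- This and the rules below turn `X ▷ -` of structural morphisms into morphisms of `C` acting on
`m`, which reduces later identities to identities in `C`. -/
theorem actionHomRight_actionHomLeft (X : C) {Y Z : C} (f : Y ⟶ Z) (m : M) :
    X ⊴ₗ (f ⊵ₗ m) = (αₗ X Y m).inv ≫ (X ◁ f) ⊵ₗ m ≫ (αₗ X Z m).hom := by simp

theorem actionHomRight_actionUnitIso_inv (X : C) (m : M) :
    X ⊴ₗ (λₗ[C] m).inv = (ρ_ X).inv ⊵ₗ m ≫ (αₗ X (𝟙_ C) m).hom := by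
  rw [← cancel_epi (X ⊴ₗ (λₗ[C] m).hom), actionHomRight_hom_inv,
    ← cancel_epi (αₗ X (𝟙_ C) m).hom, ← rightUnitor_actionHom_assoc, hom_inv_actionHomLeft_assoc,
    Category.comp_id]

theorem actionHomRight_actionUnitIso_hom (X : C) (m : M) :
    X ⊴ₗ (λₗ[C] m).hom = (αₗ X (𝟙_ C) m).inv ≫ (ρ_ X).hom ⊵ₗ m := by simp

theorem actionUnitIso_action_hom (X : C) (m : M) :
    (λₗ[C] (X ⊙ₗ m)).hom = (αₗ (𝟙_ C) X m).inv ≫ (λ_ X).hom ⊵ₗ m := by simp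

theorem actionUnitIso_action_inv (X : C) (m : M) :
    (λₗ[C] (X ⊙ₗ m)).inv = (λ_ X).inv ⊵ₗ m ≫ (αₗ (𝟙_ C) X m).hom := by
  rw [← cancel_epi (λₗ[C] (X ⊙ₗ m)).hom, Iso.hom_inv_id, actionUnitIso_action_hom,
    Category.assoc, hom_inv_actionHomLeft_assoc, Iso.inv_hom_id]

theorem actionHomRight_actionAssocIso_hom (X Y Z : C) (m : M) :
    X ⊴ₗ (αₗ Y Z m).hom = (αₗ X (Y ⊗ Z) m).inv ≫ (α_ X Y Z).inv ⊵ₗ m ≫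
      (αₗ (X ⊗ Y) Z m).hom ≫ (αₗ X Y (Z ⊙ₗ m)).hom := by
  rw [← associator_actionHom, inv_hom_actionHomLeft_assoc, Iso.inv_hom_id_assoc]

theorem actionHomRight_actionAssocIso_inv (X Y Z : C) (m : M) :
    X ⊴ₗ (αₗ Y Z m).inv = (αₗ X Y (Z ⊙ₗ m)).inv ≫ (αₗ (X ⊗ Y) Z m).inv ≫
      (α_ X Y Z).hom ⊵ₗ m ≫ (αₗ X (Y ⊗ Z) m).hom := by
  rw [← cancel_epi (X ⊴ₗ (αₗ Y Z m).hom), actionHomRight_hom_inv,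
    actionHomRight_actionAssocIso_hom]
  simp

theorem tensor_actionHomRight_comp_inv (X Y : C) {m n : M} (f : m ⟶ n) :
    X ⊴ₗ Y ⊴ₗ f = (αₗ X Y m).inv ≫ (X ⊗ Y) ⊴ₗ f ≫ (αₗ X Y n).hom := by simp

end ActionCoherence

/-! ### The adjunction between `X^* ▷ -` and `X ▷ -` -/

section Curry

open MonoidalLeftAction

variable {C : Type u₁} [Category.{v₁} C] [MonoidalCategory C] [RightRigidCategory C]
variable {M : Type u₂} [Category.{v₂} M] [MonoidalLeftAction C M]

/-- The morphism `a ⟶ X ▷ n` attached to `X^* ▷ a ⟶ n`. -/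
def dualCurry (X : C) {a n : M} (t : dual X ⊙ₗ a ⟶ n) : a ⟶ X ⊙ₗ n :=
  (λₗ[C] a).inv ≫ coev X ⊵ₗ a ≫ (αₗ X (dual X) a).hom ≫ X ⊴ₗ t

/-- The morphism `X^* ▷ a ⟶ n` attached to `a ⟶ X ▷ n`. -/
def dualUncurry (X : C) {a n : M} (s : a ⟶ X ⊙ₗ n) : dual X ⊙ₗ a ⟶ n :=
  dual X ⊴ₗ s ≫ (αₗ (dual X) X n).inv ≫ ev X ⊵ₗ n ≫ (λₗ[C] n).hom

theorem dualUncurry_dualCurry (X : C) {a n : M} (t : dual X ⊙ₗ a ⟶ n) :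
    dualUncurry X (dualCurry X t) = t := by
  -- The zigzag identity for `X^*`, applied to `a` once `t` has been moved past the evaluation.
  have h : (ρ_ (dual X)).inv ≫ dual X ◁ coev X ≫ (α_ _ _ _).inv ≫ ev X ▷ dual X ≫
      (λ_ (dual X)).hom = 𝟙 _ := by simp
  have h' := congrArg (· ⊵ₗ a) h
  simp only [comp_actionHomLeft, id_actionHomLeft] at h'
  have e : (dual X ⊗ X) ⊴ₗ t ≫ ev X ⊵ₗ n ≫ (λₗ[C] n).hom =
      ev X ⊵ₗ (dual X ⊙ₗ a) ≫ (λₗ[C] (dual X ⊙ₗ a)).hom ≫ t := by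
    rw [action_exchange_assoc, actionUnitIso_hom_naturality]
  simp only [dualUncurry, dualCurry, actionHomRight_comp, Category.assoc,
    tensor_actionHomRight_comp_inv, Iso.hom_inv_id_assoc, e]
  simp only [actionHomRight_actionHomLeft, actionHomRight_actionAssocIso_hom,
    actionHomRight_actionUnitIso_inv, actionUnitIso_action_hom, actionHomLeft_action,
    Category.assoc, Iso.hom_inv_id_assoc]
  rw [reassoc_of% h']

theorem dualCurry_dualUncurry (X : C) {a n : M} (s : a ⟶ X ⊙ₗ n) :
    dualCurry X (dualUncurry X s) = s := by
  have h : (λ_ X).inv ≫ coev X ▷ X ≫ (α_ _ _ _).hom ≫ X ◁ ev X ≫ (ρ_ X).hom = 𝟙 _ := by simp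
  have h' := congrArg (· ⊵ₗ n) h
  simp only [comp_actionHomLeft, id_actionHomLeft] at h'
  have e : (λₗ[C] a).inv ≫ coev X ⊵ₗ a ≫ (X ⊗ dual X) ⊴ₗ s =
      s ≫ (λₗ[C] (X ⊙ₗ n)).inv ≫ coev X ⊵ₗ (X ⊙ₗ n) := by
    rw [← action_exchange, actionUnitIso_inv_naturality_assoc]
  simp only [dualUncurry, dualCurry, actionHomRight_comp,
    tensor_actionHomRight_comp_inv, Category.assoc, Iso.hom_inv_id_assoc]
  rw [reassoc_of% e]
  simp only [actionHomRight_actionHomLeft, actionHomRight_actionAssocIso_inv,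
    actionHomRight_actionUnitIso_hom, actionUnitIso_action_inv, actionHomLeft_action,
    Category.assoc, Iso.hom_inv_id_assoc]
  rw [h', Category.comp_id]

theorem comp_dualCurry (X : C) {a a' n : M} (g : a' ⟶ a) (t : dual X ⊙ₗ a ⟶ n) :
    g ≫ dualCurry X t = dualCurry X (dual X ⊴ₗ g ≫ t) := by
  simp only [dualCurry, actionHomRight_comp, tensor_actionHomRight_comp_inv, Category.assoc,
    Iso.hom_inv_id_assoc]
  rw [← action_exchange_assoc, actionUnitIso_inv_naturality_assoc]

theorem dualCurry_injective (X : C) {a n : M} {t t' : dual X ⊙ₗ a ⟶ n}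
    (h : dualCurry X t = dualCurry X t') : t = t' := by
  rw [← dualUncurry_dualCurry X t, h, dualUncurry_dualCurry]

theorem comp_dualUncurry (X : C) {a a' n : M} (g : a' ⟶ a) (s : a ⟶ X ⊙ₗ n) :
    dual X ⊴ₗ g ≫ dualUncurry X s = dualUncurry X (g ≫ s) := by
  simp only [dualUncurry, actionHomRight_comp, Category.assoc]

theorem dualCurry_dualMap {X Y : C} (u : X ⟶ Y) {a n : M} (t : dual X ⊙ₗ a ⟶ n) :
    dualCurry Y (dualMap u ⊵ₗ a ≫ t) = dualCurry X t ≫ u ⊵ₗ n := by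
  have h := congrArg (· ⊵ₗ a) (coevaluation_comp_rightAdjointMate u)
  simp only [comp_actionHomLeft, whiskerLeft_actionHomLeft, whiskerRight_actionHomLeft] at h
  have h' := h =≫ (αₗ Y (dual X) a).hom
  simp only [Category.assoc, Iso.inv_hom_id, Category.comp_id] at h'
  simp only [dualCurry, actionHomRight_comp, Category.assoc]
  rw [reassoc_of% h', action_exchange]

theorem dualMap_dualUncurry {X Y : C} (u : X ⟶ Y) {a n : M} (s : a ⟶ X ⊙ₗ n) :
    dualMap u ⊵ₗ a ≫ dualUncurry X s = dualUncurry Y (s ≫ u ⊵ₗ n) := by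
  apply dualCurry_injective
  rw [dualCurry_dualMap, dualCurry_dualUncurry, dualCurry_dualUncurry]

end Curry

/-! ### The canonical coaction of the coend -/

section Coaction

open MonoidalLeftAction

variable {C : Type u₁} [Category.{v₁} C] [MonoidalCategory C] [RightRigidCategory C]

/-- The canonical coaction `X ⟶ X ⊗ K` of the coend `K`. -/
def coaction (K : Cowedge (dualTensor C)) (X : C) : X ⟶ X ⊗ K.pt :=
  (λ_ X).inv ≫ coev X ▷ X ≫ (α_ _ _ _).hom ≫ X ◁ cowedgeι K X

variable {M : Type u₂} [Category.{v₂} M] [MonoidalLeftAction C M]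

/-- The natural family `X ▷ m ⟶ X ▷ n` attached to a morphism `K ▷ m ⟶ n`. -/
def coactionHom (K : Cowedge (dualTensor C)) {m n : M} (f : K.pt ⊙ₗ m ⟶ n) (X : C) :
    X ⊙ₗ m ⟶ X ⊙ₗ n :=
  coaction K X ⊵ₗ m ≫ (αₗ X K.pt m).hom ≫ X ⊴ₗ f

theorem coactionHom_eq_dualCurry (K : Cowedge (dualTensor C)) {m n : M} (f : K.pt ⊙ₗ m ⟶ n)
    (X : C) : coactionHom K f X =
      dualCurry X ((αₗ (dual X) X m).inv ≫ cowedgeι K X ⊵ₗ m ≫ f) := by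
  simp only [coactionHom, coaction, dualCurry, actionHomRight_comp, comp_actionHomLeft,
    actionHomRight_actionAssocIso_inv, actionHomRight_actionHomLeft,
    actionUnitIso_action_inv, actionHomLeft_action, Category.assoc, Iso.hom_inv_id_assoc]

theorem coactionHom_comp (K : Cowedge (dualTensor C)) {m n n' : M} (f : K.pt ⊙ₗ m ⟶ n) (g : n ⟶ n')
    (X : C) : coactionHom K (f ≫ g) X = coactionHom K f X ≫ X ⊴ₗ g := by
  simp only [coactionHom, actionHomRight_comp, Category.assoc]

theorem comp_coactionHom (K : Cowedge (dualTensor C)) {m m' n : M} (g : m ⟶ m')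
    (f : K.pt ⊙ₗ m' ⟶ n) (X : C) :
    coactionHom K (K.pt ⊴ₗ g ≫ f) X = X ⊴ₗ g ≫ coactionHom K f X := by
  simp only [coactionHom, actionHomRight_comp, tensor_actionHomRight_comp_inv, Category.assoc,
    Iso.hom_inv_id_assoc, action_exchange_assoc]

/-- The transpose of the dinaturality of `ι`. -/
theorem coactionHom_naturality (K : Cowedge (dualTensor C)) {m n : M} (f : K.pt ⊙ₗ m ⟶ n)
    {X Y : C} (u : X ⟶ Y) : u ⊵ₗ m ≫ coactionHom K f Y = coactionHom K f X ≫ u ⊵ₗ n := by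
  rw [coactionHom_eq_dualCurry, coactionHom_eq_dualCurry, comp_dualCurry, ← dualCurry_dualMap]
  congr 1
  have h := congrArg (· ⊵ₗ m) (cowedge_condition K u)
  simp only [comp_actionHomLeft] at h
  simp only [actionHomRight_actionHomLeft, actionHomLeft_action, Category.assoc,
    Iso.hom_inv_id_assoc, reassoc_of% h]

theorem coactionHom_eq_iff (K : Cowedge (dualTensor C)) {m n : M} (f : K.pt ⊙ₗ m ⟶ n)
    (X : C) (e : X ⊙ₗ m ⟶ X ⊙ₗ n) : coactionHom K f X = e ↔
      cowedgeι K X ⊵ₗ m ≫ f = (αₗ (dual X) X m).hom ≫ dualUncurry X e := by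
  rw [coactionHom_eq_dualCurry, ← Iso.inv_comp_eq]
  exact ⟨fun h => by rw [← h, dualUncurry_dualCurry], fun h => by rw [h, dualCurry_dualUncurry]⟩

theorem coaction_naturality (K : Cowedge (dualTensor C)) {X Y : C} (u : X ⟶ Y) :
    u ≫ coaction K Y = coaction K X ≫ u ▷ K.pt := by
  -- In the regular module category, the coaction is the family attached to `K ⊗ 𝟙 ≅ K`.
  have h := coactionHom_naturality (M := C) K (ρ_ K.pt).hom u
  change u ▷ 𝟙_ C ≫ (coaction K Y ▷ 𝟙_ C ≫ (α_ _ _ _).hom ≫ Y ◁ (ρ_ K.pt).hom) =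
    (coaction K X ▷ 𝟙_ C ≫ (α_ _ _ _).hom ≫ X ◁ (ρ_ K.pt).hom) ≫ u ▷ K.pt at h
  simpa using h

end Coaction

/-! ### The universal property in module categories -/

section Universal

open MonoidalLeftAction

/-- The functors `(- ▷ m)` are additive and right exact. -/
class IsRightExactAction (C : Type u₁) [Category.{v₁} C] [Abelian C] [MonoidalCategory C]
    (M : Type u₂) [Category.{v₂} M] [Abelian M] [MonoidalLeftAction C M] : Prop where
  additive : ∀ m : M, (actionRight C m).Additive
  preservesFiniteColimits : ∀ m : M, PreservesFiniteColimits (actionRight C m)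

theorem IsFiniteModuleCategory.isRightExactAction (k : Type w) [Field k]
    {C : Type u₁} [Category.{v₁} C] [Abelian C] [Linear k C] [MonoidalCategory C]
    {M : Type u₂} [Category.{v₂} M] [Abelian M] [Linear k M] [MonoidalLeftAction C M]
    [IsFiniteModuleCategory k C M] : IsRightExactAction C M where
  additive m := ⟨fun {_ _ f g} => IsFiniteModuleCategory.add_actionHomLeft k f g m⟩
  preservesFiniteColimits := IsFiniteModuleCategory.preservesFiniteColimits k

variable {C : Type u₁} [Category.{v₁} C] [Abelian C] [MonoidalCategory C]
  [MonoidalPreadditive C] [RightRigidCategory C]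
variable {M : Type u₂} [Category.{v₂} M] [Abelian M] [MonoidalLeftAction C M]

/-- Here `(- ⊗ m)` is right exact because it is left adjoint to `(- ⊗ m^*)`. This makes the
universal property available inside `C`. -/
instance : IsRightExactAction C C where
  additive m := inferInstanceAs (tensorRight m).Additive
  preservesFiniteColimits m := inferInstanceAs (PreservesFiniteColimits (tensorRight m))

theorem coactionHom_injective [IsRightExactAction C M] (k : Type w) [Field k] [Linear k C]
    [IsFiniteCategory k C] {K : Cowedge (dualTensor C)} (hK : IsColimit K) {m n : M}
    {f g : K.pt ⊙ₗ m ⟶ n}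
    (h : ∀ X, coactionHom K f X = coactionHom K g X) : f = g := by
  have := IsRightExactAction.preservesFiniteColimits (C := C) m
  refine map_cowedge_hom_ext k hK (actionRight C m) fun X => ?_
  exact ((coactionHom_eq_iff K f X _).1 (h X)).trans ((coactionHom_eq_iff K g X _).1 rfl).symm

theorem exists_coactionHom_eq [IsRightExactAction C M] (k : Type w) [Field k] [Linear k C]
    [MonoidalLinear k C] [IsFiniteCategory k C] {K : Cowedge (dualTensor C)} (hK : IsColimit K)
    {m n : M} (e : ∀ X : C, X ⊙ₗ m ⟶ X ⊙ₗ n)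
    (he : ∀ ⦃X Y : C⦄ (u : X ⟶ Y), u ⊵ₗ m ≫ e Y = e X ≫ u ⊵ₗ n) :
    ∃ f : K.pt ⊙ₗ m ⟶ n, ∀ X, coactionHom K f X = e X := by
  have := IsRightExactAction.preservesFiniteColimits (C := C) m
  have := IsRightExactAction.additive (C := C) m
  -- Naturality of `e` transposes to dinaturality in `X^* ⊗ X`.
  have h : ∀ ⦃X Y : C⦄ (u : X ⟶ Y),
      (dualMap u ▷ X) ⊵ₗ m ≫ (αₗ (dual X) X m).hom ≫ dualUncurry X (e X) =
        (dual Y ◁ u) ⊵ₗ m ≫ (αₗ (dual Y) Y m).hom ≫ dualUncurry Y (e Y) := fun X Y u => by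
    rw [whiskerRight_actionHomLeft, whiskerLeft_actionHomLeft]
    simp only [Category.assoc, Iso.inv_hom_id_assoc]
    rw [dualMap_dualUncurry, comp_dualUncurry, he]
  obtain ⟨f, hf⟩ := exists_map_cowedge_desc k hK (actionRight C m) _ h
  exact ⟨f, fun X => (coactionHom_eq_iff K f X _).2 (hf X)⟩

end Universal

/-! ### The product expressed through coactions -/

section CoactionMul

variable {C : Type u₁} [Category.{v₁} C] [MonoidalCategory C] [RightRigidCategory C]

theorem coev_tensor (X Y : C) : coev (X ⊗ Y) =
    coev X ⊗≫ (X ◁ coev Y) ▷ dual X ⊗≫ (X ⊗ Y) ◁ (dualTensorIso X Y).hom := by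
  -- `dualTensorIso` is the mate of the identity of `X ⊗ Y` with respect to its two duals, named
  -- here explicitly.
  have h := @coevaluation_comp_rightAdjointMate C _ _ (X ⊗ Y) (X ⊗ Y)
    ⟨dual (X ⊗ Y)⟩ ⟨dual Y ⊗ dual X⟩ (𝟙 (X ⊗ Y))
  rw [id_whiskerRight, Category.comp_id] at h
  refine h.symm.trans ?_
  change (coev X ⊗≫ (X ◁ coev Y) ▷ dual X ⊗≫ 𝟙 _) ≫ (X ⊗ Y) ◁ (dualTensorIso X Y).hom = _
  monoidal

theorem coev_comp_injective {X W V : C} {t t' : dual X ⊗ V ⟶ W}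
    (h : (λ_ V).inv ≫ coev X ▷ V ≫ (α_ _ _ _).hom ≫ X ◁ t =
      (λ_ V).inv ≫ coev X ▷ V ≫ (α_ _ _ _).hom ≫ X ◁ t') : t = t' :=
  dualCurry_injective (M := C) X h

theorem cowedgeι_eq_coaction (K : Cowedge (dualTensor C)) (X : C) :
    cowedgeι K X = dual X ◁ coaction K X ≫ (α_ _ _ _).inv ≫ ev X ▷ K.pt ≫ (λ_ K.pt).hom :=
  (dualUncurry_dualCurry (M := C) X (cowedgeι K X)).symm

theorem ev_unit_comp_eq_iff (K : Cowedge (dualTensor C)) (one : 𝟙_ C ⟶ K.pt) :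
    ev (𝟙_ C) ≫ one = cowedgeι K (𝟙_ C) ↔ coaction K (𝟙_ C) = one ≫ (λ_ K.pt).inv := by
  constructor
  · intro h
    have h' : (λ_ (𝟙_ C)).inv ≫ coev (𝟙_ C) ▷ 𝟙_ C ≫ (α_ _ _ _).hom ≫ 𝟙_ C ◁ ev (𝟙_ C) =
      (ρ_ (𝟙_ C)).inv := by
      rw [ExactPairing.evaluation_coevaluation, Iso.inv_hom_id_assoc]
    rw [coaction, ← h, whiskerLeft_comp, reassoc_of% h']
    monoidal
  · intro h
    rw [cowedgeι_eq_coaction, h]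
    calc
      _ = 𝟙 _ ⊗≫ (ev (𝟙_ C) ▷ 𝟙_ C ≫ 𝟙_ C ◁ one) ⊗≫ 𝟙 _ := by monoidal
      _ = _ := by rw [← whisker_exchange]; monoidal

variable [BraidedCategory C]

theorem shuffle_eq (X Y : C) : shuffle X Y =
    𝟙 _ ⊗≫ (β_ (dual X ⊗ X) (dual Y)).hom ▷ Y ⊗≫ (dualTensorIso X Y).hom ▷ (X ⊗ Y) := by
  rw [BraidedCategory.braiding_tensor_left_hom]
  simp only [shuffle]
  monoidal

instance isIso_shuffle (X Y : C) : IsIso (shuffle X Y) := by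
  simp only [shuffle]
  infer_instance

/-- The two braidings of `shuffle` and the one of `tensorμ` combine into a braiding of `X^* ⊗ X`
past `Y ⊗ Y^*`. By naturality `coev Y` slides through it, leaving a trivial braiding with `𝟙`. -/
theorem coev_tensor_eq_shuffle (X Y : C) :
    (λ_ (X ⊗ Y)).inv ≫ coev (X ⊗ Y) ▷ (X ⊗ Y) ≫ (α_ _ _ _).hom =
      (((λ_ X).inv ≫ coev X ▷ X ≫ (α_ _ _ _).hom) ⊗ₘ ((λ_ Y).inv ≫ coev Y ▷ Y ≫ (α_ _ _ _).hom)) ≫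
        tensorμ X (dual X ⊗ X) Y (dual Y ⊗ Y) ≫ (X ⊗ Y) ◁ shuffle X Y := by
  symm
  calc
    _ = 𝟙 _ ⊗≫ coev X ▷ (X ⊗ Y) ⊗≫ X ◁ ((dual X ⊗ X) ◁ coev Y ≫
          (β_ (dual X ⊗ X) (Y ⊗ dual Y)).hom) ▷ Y ⊗≫
          (X ⊗ Y) ◁ (dualTensorIso X Y).hom ▷ (X ⊗ Y) := by
      rw [BraidedCategory.braiding_tensor_right_hom, shuffle_eq, tensorμ,
        MonoidalCategory.tensorHom_def]
      monoidal
    _ = _ := by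
      rw [BraidedCategory.braiding_naturality_right, braiding_tensorUnit_right, coev_tensor]
      monoidal

/-- The iterated coaction `X ⊗ Y ⟶ (X ⊗ Y) ⊗ (K ⊗ K)` in which the factor `K` of `X` comes
first. -/
def coactionTensor (K : Cowedge (dualTensor C)) (X Y : C) : X ⊗ Y ⟶ (X ⊗ Y) ⊗ (K.pt ⊗ K.pt) :=
  (coaction K X ⊗ₘ coaction K Y) ≫ tensorμ X K.pt Y K.pt

/-- The morphism `X ⊗ Y ⟶ X ⊗ (Y ⊗ K)` that coacts on `X` and moves the factor `K` under `Y`. -/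
def coactionUnder (K : Cowedge (dualTensor C)) (X Y : C) : X ⊗ Y ⟶ X ⊗ (Y ⊗ K.pt) :=
  coaction K X ▷ Y ≫ (α_ _ _ _).hom ≫ X ◁ (β_ Y K.pt).inv

theorem coactionUnder_eq (K : Cowedge (dualTensor C)) (X Y : C) : coactionUnder K X Y =
    (β_ Y X).inv ≫ Y ◁ coaction K X ≫ (α_ _ _ _).inv ≫ (β_ Y X).hom ▷ K.pt ≫ (α_ _ _ _).hom := by
  rw [coactionUnder, Iso.eq_inv_comp, ← BraidedCategory.braiding_naturality_right_assoc,
    BraidedCategory.braiding_tensor_right_hom]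
  simp

/-- The coaction of the coend on tensor products is compatible with `mul`. -/
def IsMultiplicative (K : Cowedge (dualTensor C)) (mul : K.pt ⊗ K.pt ⟶ K.pt) : Prop :=
  ∀ X Y : C, coaction K (X ⊗ Y) ≫ (α_ _ _ _).hom =
    coactionUnder K X Y ≫ X ◁ (coaction K Y ▷ K.pt ≫ (α_ _ _ _).hom ≫ Y ◁ mul)

/-- Conjugation by the braiding of `Y` and `X` relates the two forms, by naturality of the coaction.
The order of `X` and `Y` is therefore reversed. -/
theorem coaction_tensor_eq_iff (K : Cowedge (dualTensor C)) (mul : K.pt ⊗ K.pt ⟶ K.pt) (X Y : C) :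
    coaction K (X ⊗ Y) ≫ (α_ _ _ _).hom =
      coactionUnder K X Y ≫ X ◁ (coaction K Y ▷ K.pt ≫ (α_ _ _ _).hom ≫ Y ◁ mul) ↔
    coaction K (Y ⊗ X) = coactionTensor K Y X ≫ (Y ⊗ X) ◁ mul := by
  have h₁ := coaction_naturality K (β_ Y X).hom
  have h₂ : (β_ Y X).hom ≫ coactionUnder K X Y ≫
      X ◁ (coaction K Y ▷ K.pt ≫ (α_ _ _ _).hom ≫ Y ◁ mul) =
      (coactionTensor K Y X ≫ (Y ⊗ X) ◁ mul) ≫ (β_ Y X).hom ▷ K.pt ≫ (α_ _ _ _).hom := by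
    rw [coactionUnder_eq, Category.assoc, Iso.hom_inv_id_assoc]
    calc
      _ = 𝟙 _ ⊗≫ Y ◁ coaction K X ⊗≫ ((β_ Y X).hom ≫ X ◁ coaction K Y) ▷ K.pt ⊗≫
          X ◁ Y ◁ mul := by monoidal
      _ = 𝟙 _ ⊗≫ (Y ◁ coaction K X ≫ coaction K Y ▷ _) ⊗≫ Y ◁ (β_ K.pt X).hom ▷ K.pt ⊗≫
          ((β_ Y X).hom ▷ (K.pt ⊗ K.pt) ≫ _ ◁ mul) ⊗≫ 𝟙 _ := by
        rw [← BraidedCategory.braiding_naturality_left, BraidedCategory.braiding_tensor_left_hom]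
        monoidal
      _ = _ := by
        rw [← whisker_exchange, whisker_exchange, coactionTensor, tensorμ,
          MonoidalCategory.tensorHom_def]
        monoidal
  rw [← cancel_epi (β_ Y X).hom, reassoc_of% h₁, h₂, ← Category.assoc, ← Category.assoc,
    cancel_mono, cancel_mono]

/-- The second identity is the first one whiskered by `X ⊗ Y` and precomposed with `T`. Nothing is
lost: up to the isomorphism `shuffle`, this is transposition along the dual of `X ⊗ Y`. -/
theorem tensorHom_comp_eq_iff (K : Cowedge (dualTensor C)) (mul : K.pt ⊗ K.pt ⟶ K.pt) (X Y : C) :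
    (cowedgeι K X ⊗ₘ cowedgeι K Y) ≫ mul = shuffle X Y ≫ cowedgeι K (X ⊗ Y) ↔
    coaction K (X ⊗ Y) = coactionTensor K X Y ≫ (X ⊗ Y) ◁ mul := by
  let T := (((λ_ X).inv ≫ coev X ▷ X ≫ (α_ _ _ _).hom) ⊗ₘ
      ((λ_ Y).inv ≫ coev Y ▷ Y ≫ (α_ _ _ _).hom)) ≫ tensorμ X (dual X ⊗ X) Y (dual Y ⊗ Y)
  have h₁ : coaction K (X ⊗ Y) = T ≫ (X ⊗ Y) ◁ (shuffle X Y ≫ cowedgeι K (X ⊗ Y)) := by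
    have h := coev_tensor_eq_shuffle X Y =≫ (X ⊗ Y) ◁ cowedgeι K (X ⊗ Y)
    simpa [T, coaction] using h
  have h₂ : coactionTensor K X Y ≫ (X ⊗ Y) ◁ mul =
      T ≫ (X ⊗ Y) ◁ ((cowedgeι K X ⊗ₘ cowedgeι K Y) ≫ mul) := by
    have h := tensorμ_natural (𝟙 X) (cowedgeι K X) (𝟙 Y) (cowedgeι K Y)
    simp only [id_tensorHom, whiskerLeft_id] at h
    rw [whiskerLeft_comp, coactionTensor]
    simp only [T, Category.assoc]
    rw [← reassoc_of% h, tensorHom_comp_tensorHom_assoc]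
    simp [coaction]
  rw [h₁, h₂]
  refine ⟨fun h => by rw [h], fun h => ?_⟩
  have hs (W : C) (t : (dual X ⊗ X) ⊗ (dual Y ⊗ Y) ⟶ W) :
      T ≫ (X ⊗ Y) ◁ t = (λ_ (X ⊗ Y)).inv ≫ coev (X ⊗ Y) ▷ (X ⊗ Y) ≫ (α_ _ _ _).hom ≫
        (X ⊗ Y) ◁ (inv (shuffle X Y) ≫ t) := by
    have h := coev_tensor_eq_shuffle X Y =≫ (X ⊗ Y) ◁ (inv (shuffle X Y) ≫ t)
    simp only [Category.assoc] at h
    rw [h, ← whiskerLeft_comp, IsIso.hom_inv_id_assoc]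
    simp only [T, Category.assoc]
  rw [hs, hs] at h
  exact ((cancel_epi _).1 (coev_comp_injective h)).symm

theorem isMultiplicative_iff (K : Cowedge (dualTensor C)) (mul : K.pt ⊗ K.pt ⟶ K.pt) :
    IsMultiplicative K mul ↔ ∀ X Y : C,
      (cowedgeι K X ⊗ₘ cowedgeι K Y) ≫ mul = shuffle X Y ≫ cowedgeι K (X ⊗ Y) := by
  simp only [IsMultiplicative, coaction_tensor_eq_iff, tensorHom_comp_eq_iff]
  exact forall_comm

end CoactionMul

/-! ### Construction of the coend algebra -/

section CrossMul

variable {C : Type u₁} [Category.{v₁} C] [MonoidalCategory C] [RightRigidCategory C]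
  [BraidedCategory C] {K : Cowedge (dualTensor C)} (mul : K.pt ⊗ K.pt ⟶ K.pt)

/-- The morphism `K ⊗ Y ⟶ Y ⊗ K` that moves `K` under `Y`, coacts on `Y` and multiplies. -/
def crossMul (Y : C) : K.pt ⊗ Y ⟶ Y ⊗ K.pt :=
  (β_ Y K.pt).inv ≫ coaction K Y ▷ K.pt ≫ (α_ _ _ _).hom ≫ Y ◁ mul

theorem braiding_comp_crossMul (Y : C) : (β_ Y K.pt).hom ≫ crossMul mul Y =
    coaction K Y ▷ K.pt ≫ (α_ _ _ _).hom ≫ Y ◁ mul := by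
  rw [crossMul, Iso.hom_inv_id_assoc]

variable {mul}

theorem IsMultiplicative.coaction_tensor (h : IsMultiplicative K mul) (X Y : C) :
    coaction K (X ⊗ Y) ≫ (α_ _ _ _).hom =
      coaction K X ▷ Y ≫ (α_ _ _ _).hom ≫ X ◁ crossMul mul Y := by
  rw [h, coactionUnder, crossMul]
  simp

theorem isMultiplicative_of_coaction_tensor (h : ∀ X Y : C, coaction K (X ⊗ Y) ≫ (α_ _ _ _).hom =
      coaction K X ▷ Y ≫ (α_ _ _ _).hom ≫ X ◁ crossMul mul Y) : IsMultiplicative K mul := by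
  intro X Y
  rw [h, coactionUnder, crossMul]
  simp

end CrossMul

section Algebra

variable {C : Type u₁} [Category.{v₁} C] [Abelian C] [MonoidalCategory C]
  [MonoidalPreadditive C] [RightRigidCategory C]

theorem coaction_hom_ext (k : Type w) [Field k] [Linear k C] [IsFiniteCategory k C]
    {K : Cowedge (dualTensor C)} (hK : IsColimit K)
    {Z W : C} {f g : K.pt ⊗ Z ⟶ W}
    (h : ∀ X, coaction K X ▷ Z ≫ (α_ _ _ _).hom ≫ X ◁ f =
      coaction K X ▷ Z ≫ (α_ _ _ _).hom ≫ X ◁ g) : f = g :=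
  coactionHom_injective (M := C) k hK h

theorem exists_coaction_comp_eq (k : Type w) [Field k] [Linear k C] [MonoidalLinear k C]
    [IsFiniteCategory k C] {K : Cowedge (dualTensor C)} (hK : IsColimit K) {Z W : C}
    (e : ∀ X : C, X ⊗ Z ⟶ X ⊗ W)
    (he : ∀ ⦃X Y : C⦄ (u : X ⟶ Y), u ▷ Z ≫ e Y = e X ≫ u ▷ W) :
    ∃ f : K.pt ⊗ Z ⟶ W, ∀ X, coaction K X ▷ Z ≫ (α_ _ _ _).hom ≫ X ◁ f = e X :=
  exists_coactionHom_eq (M := C) k hK e he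

variable [BraidedCategory C]

/-- The universal property is used twice: in `X` with `Y` fixed it yields `g Y : K ⊗ Y ⟶ Y ⊗ K`;
these are natural in `Y`, and after braiding they determine the product. -/
theorem exists_isMultiplicative (k : Type w) [Field k] [Linear k C] [MonoidalLinear k C]
    [IsFiniteCategory k C] {K : Cowedge (dualTensor C)} (hK : IsColimit K) :
    ∃ mul : K.pt ⊗ K.pt ⟶ K.pt, IsMultiplicative K mul := by
  have h₁ (Y : C) := exists_coaction_comp_eq k hK (fun X => coaction K (X ⊗ Y) ≫ (α_ _ _ _).hom)
    fun X X' u => by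
      rw [← Category.assoc, coaction_naturality]
      simp
  choose g hg using h₁
  have hnat ⦃Y Y' : C⦄ (u : Y ⟶ Y') : K.pt ◁ u ≫ g Y' = g Y ≫ u ▷ K.pt := by
    refine coaction_hom_ext k hK fun X => ?_
    have h := coaction_naturality K (X ◁ u) =≫ (α_ _ _ _).hom
    have hgY := hg Y X
    rw [Category.assoc, ← hg, Category.assoc, whisker_assoc, Category.assoc, Category.assoc,
      Iso.inv_hom_id, Category.comp_id, ← reassoc_of% hgY] at h
    rw [whiskerLeft_comp, whiskerLeft_comp, ← h, ← associator_naturality_right_assoc,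
      whisker_exchange_assoc]
  obtain ⟨mul, hmul⟩ := exists_coaction_comp_eq k hK (fun Y => (β_ Y K.pt).hom ≫ g Y)
    fun Y Y' u => by
      rw [Category.assoc, ← hnat, BraidedCategory.braiding_naturality_left_assoc]
  refine ⟨mul, isMultiplicative_of_coaction_tensor fun X Y => ?_⟩
  rw [crossMul, hmul, Iso.inv_hom_id_assoc, hg]

variable {K : Cowedge (dualTensor C)} {mul : K.pt ⊗ K.pt ⟶ K.pt}

/-- Both sides describe the coaction on a triple tensor product, for its two bracketings. -/
theorem IsMultiplicative.crossMul_tensor (k : Type w) [Field k] [Linear k C] [IsFiniteCategory k C]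
    (hK : IsColimit K) (h : IsMultiplicative K mul) (Y Z : C) :
    crossMul mul (Y ⊗ Z) = (α_ _ _ _).inv ≫ crossMul mul Y ▷ Z ≫ (α_ _ _ _).hom ≫
      Y ◁ crossMul mul Z ≫ (α_ _ _ _).inv := by
  refine coaction_hom_ext k hK fun X => ?_
  have h₁ := h.coaction_tensor X (Y ⊗ Z)
  have h₂ := h.coaction_tensor (X ⊗ Y) Z
  have h₃ := coaction_naturality K (α_ X Y Z).inv
  have h₄ := congrArg (· ▷ Z) (h.coaction_tensor X Y)
  simp only [comp_whiskerRight] at h₄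
  calc
    _ = (α_ X Y Z).inv ≫ (coaction K ((X ⊗ Y) ⊗ Z) ≫ (α_ _ _ _).hom) ≫ (α_ _ _ _).hom ≫
        X ◁ (α_ _ _ _).inv := by
      rw [← h₁, Category.assoc, reassoc_of% h₃]
      monoidal
    _ = (α_ X Y Z).inv ≫ (coaction K (X ⊗ Y) ▷ Z ≫ (α_ _ _ _).hom ▷ Z) ⊗≫ X ◁ Y ◁ crossMul mul Z ⊗≫
        𝟙 _ := by
      rw [h₂]
      monoidal
    _ = _ := by
      rw [h₄]
      monoidal

theorem IsMultiplicative.mul_assoc (k : Type w) [Field k] [Linear k C] [IsFiniteCategory k C]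
    (hK : IsColimit K) (h : IsMultiplicative K mul) :
    mul ▷ K.pt ≫ mul = (α_ _ _ _).hom ≫ K.pt ◁ mul ≫ mul := by
  rw [← Iso.inv_comp_eq]
  refine coaction_hom_ext k hK fun Z => ?_
  -- Braiding `K ⊗ K` in front of `Z` exposes another leading `K`, to be tested by the coaction on
  -- `Y`.
  rw [← cancel_epi (β_ Z (K.pt ⊗ K.pt)).inv, ← cancel_epi (α_ K.pt K.pt Z).inv]
  refine coaction_hom_ext k hK fun Y => ?_
  have hc := h.crossMul_tensor k hK Y Z
  have hZ := braiding_comp_crossMul mul Z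
  have hY := braiding_comp_crossMul mul Y
  have hYZ := braiding_comp_crossMul mul (Y ⊗ Z)
  have h₁ := congrArg (· ▷ K.pt) (h.coaction_tensor Y Z)
  simp only [comp_whiskerRight] at h₁
  -- Both products reduce to `crossMul` at `Y ⊗ Z`: the first by the coaction on `Y ⊗ Z`, the second
  -- by `crossMul_tensor`.
  trans (α_ _ _ _).inv ≫ (β_ Y K.pt).hom ▷ Z ⊗≫ crossMul mul (Y ⊗ Z) ⊗≫ 𝟙 _
  · calc
      _ = coaction K Y ▷ (K.pt ⊗ Z) ⊗≫ Y ◁ (K.pt ◁ (β_ Z K.pt).inv ⊗≫ ((β_ Z K.pt).inv ≫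
          coaction K Z ▷ K.pt ≫ (α_ _ _ _).hom ≫ Z ◁ mul) ▷ K.pt ⊗≫ Z ◁ mul) := by
        rw [BraidedCategory.braiding_tensor_right_inv]
        monoidal
      _ = 𝟙 _ ⊗≫ (coaction K Y ▷ (K.pt ⊗ Z) ≫ _ ◁ (β_ Z K.pt).inv) ⊗≫
          Y ◁ crossMul mul Z ▷ K.pt ⊗≫ Y ◁ Z ◁ mul := by
        rw [crossMul]
        monoidal
      _ = 𝟙 _ ⊗≫ Y ◁ (β_ Z K.pt).inv ⊗≫ (coaction K Y ▷ Z ▷ K.pt ≫ (α_ _ _ _).hom ▷ K.pt ≫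
          (Y ◁ crossMul mul Z) ▷ K.pt) ⊗≫ Y ◁ Z ◁ mul := by
        rw [← whisker_exchange]
        monoidal
      _ = 𝟙 _ ⊗≫ Y ◁ (β_ Z K.pt).inv ⊗≫ (coaction K (Y ⊗ Z) ▷ K.pt ≫ (α_ _ _ _).hom ≫
          (Y ⊗ Z) ◁ mul) ⊗≫ 𝟙 _ := by
        rw [← h₁]
        monoidal
      _ = _ := by
        rw [← hYZ, BraidedCategory.braiding_tensor_left_hom]
        calc
          _ = 𝟙 _ ⊗≫ Y ◁ ((β_ Z K.pt).inv ≫ (β_ Z K.pt).hom) ⊗≫ (β_ Y K.pt).hom ▷ Z ⊗≫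
            crossMul mul (Y ⊗ Z) ⊗≫ 𝟙 _ := by monoidal
          _ = _ := by rw [Iso.inv_hom_id]; monoidal
  · symm
    calc
      _ = coaction K Y ▷ (K.pt ⊗ Z) ⊗≫ Y ◁ ((β_ Z (K.pt ⊗ K.pt)).inv ≫
          (coaction K Z ▷ (K.pt ⊗ K.pt) ≫ _ ◁ mul)) ⊗≫ Y ◁ Z ◁ mul := by monoidal
      _ = coaction K Y ▷ (K.pt ⊗ Z) ⊗≫ Y ◁ (((β_ Z (K.pt ⊗ K.pt)).inv ≫ Z ◁ mul) ≫
          coaction K Z ▷ K.pt) ⊗≫ Y ◁ Z ◁ mul := by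
        rw [← whisker_exchange, Category.assoc]
      _ = 𝟙 _ ⊗≫ (coaction K Y ▷ K.pt ≫ (α_ _ _ _).hom ≫ Y ◁ mul) ▷ Z ⊗≫ Y ◁ crossMul mul Z := by
        rw [← BraidedCategory.braiding_inv_naturality_left, crossMul]
        monoidal
      _ = _ := by
        rw [← hY, hc]
        monoidal

/-- This is multiplicativity at `X ⊗ 𝟙`; `mul_one` is the case `𝟙 ⊗ Y`. -/
theorem IsMultiplicative.one_mul (k : Type w) [Field k] [Linear k C] [IsFiniteCategory k C]
    (hK : IsColimit K) (h : IsMultiplicative K mul) {one : 𝟙_ C ⟶ K.pt}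
    (hone : coaction K (𝟙_ C) = one ≫ (λ_ K.pt).inv) : one ▷ K.pt ≫ mul = (λ_ K.pt).hom := by
  rw [← cancel_epi (λ_ K.pt).inv, ← cancel_epi (ρ_ K.pt).hom]
  refine coaction_hom_ext k hK fun X => ?_
  have h₁ := coaction_naturality K (ρ_ X).inv =≫ (α_ _ _ _).hom
  rw [Category.assoc, h, hone, coactionUnder, braiding_inv_tensorUnit_left] at h₁
  replace h₁ := h₁ =≫ X ◁ (λ_ K.pt).hom
  simp only [Category.assoc] at h₁
  calc
    _ = (ρ_ X).hom ≫ (ρ_ X).inv ≫ (coaction K X ▷ 𝟙_ C ≫ (α_ _ _ _).hom ≫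
        X ◁ ((ρ_ K.pt).hom ≫ (λ_ K.pt).inv)) ≫ X ◁ ((one ≫ (λ_ K.pt).inv) ▷ K.pt ≫
        (α_ _ _ _).hom ≫ 𝟙_ C ◁ mul) ≫ X ◁ (λ_ K.pt).hom := by monoidal
    _ = _ := by
      simp only [Category.assoc]
      rw [h₁]
      monoidal

theorem IsMultiplicative.mul_one (k : Type w) [Field k] [Linear k C] [IsFiniteCategory k C]
    (hK : IsColimit K) (h : IsMultiplicative K mul) {one : 𝟙_ C ⟶ K.pt}
    (hone : coaction K (𝟙_ C) = one ≫ (λ_ K.pt).inv) : K.pt ◁ one ≫ mul = (ρ_ K.pt).hom := by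
  refine coaction_hom_ext k hK fun Y => ?_
  have h₁ := coaction_naturality K (λ_ Y).inv =≫ (α_ _ _ _).hom
  rw [Category.assoc, h.coaction_tensor, hone, crossMul] at h₁
  have h₂ : coaction K Y = (ρ_ Y).inv ≫ Y ◁ one ≫ coaction K Y ▷ K.pt ≫ (α_ _ _ _).hom ≫
      Y ◁ mul := by
    calc
      _ = (coaction K Y ≫ (λ_ Y).inv ▷ K.pt) ≫ (α_ _ _ _).hom ≫ (λ_ _).hom := by monoidal
      _ = 𝟙 _ ⊗≫ (one ▷ Y ≫ (β_ Y K.pt).inv) ⊗≫ coaction K Y ▷ K.pt ⊗≫ Y ◁ mul := by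
        rw [← Category.assoc, Category.assoc _ _ (α_ _ _ _).hom, ← Category.assoc, ← h₁]
        monoidal
      _ = _ := by
        rw [BraidedCategory.braiding_inv_naturality_left, braiding_inv_tensorUnit_right]
        monoidal
  calc
    _ = 𝟙 _ ⊗≫ (coaction K Y ▷ 𝟙_ C ≫ _ ◁ one) ⊗≫ Y ◁ mul := by monoidal
    _ = (ρ_ Y).hom ≫ coaction K Y := by
      rw [← whisker_exchange]
      conv_rhs => rw [h₂]
      monoidal
    _ = _ := by monoidal

theorem exists_coendAlgebra (k : Type w) [Field k] [Linear k C] [MonoidalLinear k C]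
    [IsFiniteCategory k C] : Nonempty (CoendAlgebra C) := by
  obtain ⟨K, ⟨hK⟩⟩ := exists_isColimit_cowedge C k
  obtain ⟨mul, hmul⟩ := exists_isMultiplicative k hK
  have hone : coaction K (𝟙_ C) = (coaction K (𝟙_ C) ≫ (λ_ K.pt).hom) ≫ (λ_ K.pt).inv := by simp
  exact ⟨{
    cowedge := K
    isColimit := hK
    monObj :=
      { one := coaction K (𝟙_ C) ≫ (λ_ K.pt).hom
        mul := mul
        one_mul := hmul.one_mul k hK hone
        mul_one := hmul.mul_one k hK hone
        mul_assoc := hmul.mul_assoc k hK }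
    ev_unit_comp_one := (ev_unit_comp_eq_iff K _).2 hone
    tensorHom_comp_mul := (isMultiplicative_iff K mul).1 hmul }⟩

end Algebra

/-! ### Morphisms out of `K ▷ (K ▷ m)` -/

section Iterated

open MonoidalLeftAction

variable {C : Type u₁} [Category.{v₁} C] [MonoidalCategory C] [RightRigidCategory C]
  [BraidedCategory C] (K : Cowedge (dualTensor C))
variable {M : Type u₂} [Category.{v₂} M] [MonoidalLeftAction C M]

/-- The morphism `K ▷ (Y ▷ m) ⟶ Y ▷ n` attached to `f : K ▷ (K ▷ m) ⟶ n`: move `K` under `Y` and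
coact on `Y`. -/
def coactionSwap {m n : M} (f : K.pt ⊙ₗ K.pt ⊙ₗ m ⟶ n) (Y : C) : K.pt ⊙ₗ Y ⊙ₗ m ⟶ Y ⊙ₗ n :=
  (αₗ K.pt Y m).inv ≫ (β_ Y K.pt).inv ⊵ₗ m ≫ (αₗ Y K.pt m).hom ≫ coactionHom K f Y

theorem coactionHom_coactionSwap {m n : M} (f : K.pt ⊙ₗ K.pt ⊙ₗ m ⟶ n) (X Y : C) :
    coactionHom K (coactionSwap K f Y) X = (αₗ X Y m).inv ≫ coactionUnder K X Y ⊵ₗ m ≫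
      (αₗ X (Y ⊗ K.pt) m).hom ≫ X ⊴ₗ (αₗ Y K.pt m).hom ≫ X ⊴ₗ coactionHom K f Y := by
  rw [coactionSwap]
  generalize coactionHom K f Y = t
  simp only [coactionHom, coactionUnder, actionHomLeft_action, comp_actionHomLeft,
    actionHomRight_comp, actionHomRight_actionAssocIso_inv, actionHomRight_actionHomLeft,
    Category.assoc, Iso.hom_inv_id_assoc]

/-- Source of the conjugation by braidings in the tensor axiom: moving `K` under `Y` amounts to
swapping `Y` to the front, coacting on `X` and swapping back. -/
theorem coactionUnder_comp {m n : M} (ξ : K.pt ⊙ₗ m ⟶ n) (X Y : C) :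
    coactionUnder K X Y ⊵ₗ m ≫ (αₗ X (Y ⊗ K.pt) m).hom ≫ X ⊴ₗ (αₗ Y K.pt m).hom ≫ X ⊴ₗ Y ⊴ₗ ξ =
      (β_ Y X).inv ⊵ₗ m ≫ (αₗ Y X m).hom ≫ Y ⊴ₗ coactionHom K ξ X ≫ (αₗ Y X n).inv ≫
        (β_ Y X).hom ⊵ₗ n ≫ (αₗ X Y n).hom := by
  have h : (β_ Y X).hom ⊵ₗ (K.pt ⊙ₗ m) ≫ (X ⊗ Y) ⊴ₗ ξ =
      (Y ⊗ X) ⊴ₗ ξ ≫ (β_ Y X).hom ⊵ₗ n := (action_exchange _ _).symm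
  simp only [actionHomLeft_action, Category.assoc, Iso.inv_comp_eq] at h
  simp only [coactionUnder_eq, coactionHom, comp_actionHomLeft, actionHomRight_comp,
    Category.assoc, tensor_actionHomRight_comp_inv, actionHomRight_actionAssocIso_hom,
    actionHomRight_actionHomLeft, Iso.hom_inv_id_assoc, hom_inv_actionHomLeft_assoc,
    reassoc_of% h]

variable {K} in
theorem IsMultiplicative.coactionHom_coactionSwap_mul {mul : K.pt ⊗ K.pt ⟶ K.pt}
    (h : IsMultiplicative K mul) {m n : M} (ξ : K.pt ⊙ₗ m ⟶ n) (X Y : C) :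
    coactionHom K (coactionSwap K ((αₗ K.pt K.pt m).inv ≫ mul ⊵ₗ m ≫ ξ) Y) X =
      (αₗ X Y m).inv ≫ coactionHom K ξ (X ⊗ Y) ≫ (αₗ X Y n).hom := by
  have h' := congrArg (· ⊵ₗ m) (h X Y)
  rw [coactionHom_coactionSwap]
  simp only [comp_actionHomLeft, whiskerLeft_comp] at h'
  simp only [coactionHom, actionHomLeft_action, tensor_actionHomRight_comp_inv,
    actionHomRight_comp, actionHomRight_actionAssocIso_inv, actionHomRight_actionAssocIso_hom,
    actionHomRight_actionHomLeft, Category.assoc, Iso.hom_inv_id_assoc]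
  rw [inv_hom_actionHomLeft_assoc, ← reassoc_of% h', hom_inv_actionHomLeft_assoc]

theorem coactionHom_coactionSwap_actionHomRight {m n : M} (ξ : K.pt ⊙ₗ m ⟶ m)
    (ζ : K.pt ⊙ₗ m ⟶ n) (X Y : C) :
    coactionHom K (coactionSwap K (K.pt ⊴ₗ ξ ≫ ζ) Y) X = (αₗ X Y m).inv ≫
      (β_ Y X).inv ⊵ₗ m ≫ (αₗ Y X m).hom ≫ Y ⊴ₗ coactionHom K ξ X ≫ (αₗ Y X m).inv ≫
        (β_ Y X).hom ⊵ₗ m ≫ (αₗ X Y m).hom ≫ X ⊴ₗ coactionHom K ζ Y := by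
  have h := coactionUnder_comp K ξ X Y =≫ X ⊴ₗ coactionHom K ζ Y
  simp only [Category.assoc] at h
  rw [coactionHom_coactionSwap, comp_coactionHom, actionHomRight_comp, h]

end Iterated

/-! ### Invertibility and units of reflections -/

section Finite

/-- A one-sided inverse in a finite-dimensional endomorphism algebra is two-sided. -/
theorem isIso_of_comp_eq_id (k : Type w) [Field k] {M : Type u₂} [Category.{v₂} M] [Preadditive M]
    [Linear k M] {a : M} [FiniteDimensional k (a ⟶ a)] {f g : a ⟶ a} (h : f ≫ g = 𝟙 a) :
    IsIso f := by
  have hinj : Function.Injective (Linear.rightComp k a f) := fun s t hst => by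
    have : (s ≫ f) ≫ g = (t ≫ f) ≫ g := congrArg (· ≫ g) hst
    simpa [h] using this
  obtain ⟨t, ht⟩ := LinearMap.injective_iff_surjective.1 hinj (𝟙 a)
  replace ht : t ≫ f = 𝟙 a := ht
  have : t = g := by rw [← Category.comp_id t, ← h, reassoc_of% ht]
  exact ⟨g, h, this ▸ ht⟩

end Finite

section Reflections

open MonoidalLeftAction

variable {C : Type u₁} [Category.{v₁} C] [MonoidalCategory C] [BraidedCategory C]
variable {M : Type u₂} [Category.{v₂} M] [MonoidalLeftAction C M]

/-- At `(𝟙, 𝟙)` naturality cancels the braidings, so the tensor axiom makes `e_{𝟙 ⊗ 𝟙}` idempotent;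
being invertible, it is the identity. -/
theorem Reflection.e_unit {m : M} (r : Reflection C m) : (r.e (𝟙_ C)).hom = 𝟙 _ := by
  have h₁ : (αₗ (𝟙_ C) (𝟙_ C) m).hom ≫ 𝟙_ C ⊴ₗ (r.e (𝟙_ C)).hom ≫ (αₗ (𝟙_ C) (𝟙_ C) m).inv =
      (r.e (𝟙_ C ⊗ 𝟙_ C)).hom := by
    rw [← cancel_mono ((λ_ (𝟙_ C)).hom ⊵ₗ m), ← r.naturality]
    simp
  have h₂ := r.tensor (𝟙_ C) (𝟙_ C)
  rw [reassoc_of% h₁, h₁, reassoc_of% (r.naturality (β_ (𝟙_ C) (𝟙_ C)).inv),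
    inv_hom_actionHomLeft_assoc] at h₂
  have h₃ : (r.e (𝟙_ C ⊗ 𝟙_ C)).hom = 𝟙 _ := by
    rw [← cancel_epi (r.e (𝟙_ C ⊗ 𝟙_ C)).hom, ← h₂, Category.comp_id]
  have h₄ := r.naturality (λ_ (𝟙_ C)).hom
  rw [h₃, Category.id_comp] at h₄
  rw [← cancel_epi ((λ_ (𝟙_ C)).hom ⊵ₗ m), h₄, Category.comp_id]

/-- Reflections on `m` with the same components give isomorphic objects of the reflective center. -/
def ReflectiveCenter.isoOfEq {m : M} (r r' : Reflection C m)
    (h : ∀ X, (r.e X).hom = (r'.e X).hom) :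
    (⟨m, r⟩ : ReflectiveCenter C M) ≅ ⟨m, r'⟩ where
  hom := { hom := 𝟙 m, comm := fun X => by simp [h] }
  inv := { hom := 𝟙 m, comm := fun X => by simp [h] }
  hom_inv_id := ReflectiveCenter.Hom.ext (Category.comp_id _)
  inv_hom_id := ReflectiveCenter.Hom.ext (Category.comp_id _)

variable [RightRigidCategory C]

/-- A natural family with the tensor property of reflections has one-sided inverses. -/
theorem exists_comp_eq_id {m : M} (e : ∀ X : C, X ⊙ₗ m ⟶ X ⊙ₗ m)
    (naturality : ∀ {X Y : C} (f : X ⟶ Y), f ⊵ₗ m ≫ e Y = e X ≫ f ⊵ₗ m)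
    (tensor : ∀ X Y : C, e (X ⊗ Y) =
      (β_ Y X).inv ⊵ₗ m ≫ (αₗ Y X m).hom ≫ Y ⊴ₗ e X ≫ (αₗ Y X m).inv ≫
        (β_ Y X).hom ⊵ₗ m ≫ (αₗ X Y m).hom ≫ X ⊴ₗ e Y ≫ (αₗ X Y m).inv)
    (unit : e (𝟙_ C) = 𝟙 _) (X : C) : ∃ g, e X ≫ g = 𝟙 (X ⊙ₗ m) := by
  -- What follows `e_X` in the tensor formula at `(X, X^*)`, then evaluation. By naturality and `e_𝟙
  -- = id`, `e_X` followed by `s` is plain evaluation, so the transpose of `s` is the inverse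
  -- sought.
  let s : dual X ⊙ₗ X ⊙ₗ m ⟶ m := (αₗ (dual X) X m).inv ≫ (β_ (dual X) X).hom ⊵ₗ m ≫
    (αₗ X (dual X) m).hom ≫ X ⊴ₗ e (dual X) ≫ (αₗ X (dual X) m).inv ≫
      (β_ (dual X) X).inv ⊵ₗ m ≫ ev X ⊵ₗ m ≫ (λₗ[C] m).hom
  have hs : dual X ⊴ₗ e X ≫ s = dualUncurry X (𝟙 (X ⊙ₗ m)) := by
    have h₁ := naturality (ev X)
    rw [unit, Category.comp_id] at h₁
    have h₂ := naturality (β_ (dual X) X).inv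
    rw [dualUncurry, actionHomRight_id, Category.id_comp, h₁, ← cancel_epi (αₗ (dual X) X m).hom]
    simp only [Category.assoc, Iso.hom_inv_id_assoc]
    rw [← cancel_epi ((β_ (dual X) X).inv ⊵ₗ m), reassoc_of% h₂, tensor X (dual X)]
    simp [s]
  exact ⟨dualCurry X s, by rw [comp_dualCurry, hs, dualCurry_dualUncurry]⟩

end Reflections

/-! ### Module axioms versus reflection axioms -/

namespace CoendAlgebra

open MonoidalLeftAction

variable {C : Type u₁} [Category.{v₁} C] [MonoidalCategory C] [RightRigidCategory C]
  [BraidedCategory C] (A : CoendAlgebra C)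
variable {M : Type u₂} [Category.{v₂} M] [MonoidalLeftAction C M]

theorem isMultiplicative : IsMultiplicative A.cowedge A.monObj.mul :=
  (isMultiplicative_iff _ _).2 A.tensorHom_comp_mul

theorem coaction_unit : coaction A.cowedge (𝟙_ C) = A.monObj.one ≫ (λ_ A.pt).inv :=
  (ev_unit_comp_eq_iff _ _).1 A.ev_unit_comp_one

theorem inducedReflection_eq {m : M} (ξ : A.pt ⊙ₗ m ⟶ m) (X : C) :
    inducedReflection A ξ X = coactionHom A.cowedge ξ X := by
  simp only [coactionHom_eq_dualCurry, inducedReflection, dualCurry, actionHomRight_comp]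

theorem isInducedAction_iff {m : M} (r : Reflection C m) (ξ : A.pt ⊙ₗ m ⟶ m) :
    IsInducedAction A r ξ ↔ ∀ X, coactionHom A.cowedge ξ X = (r.e X).hom :=
  forall_congr' fun X => (coactionHom_eq_iff A.cowedge ξ X _).symm

theorem unit_iff {m : M} (ξ : A.pt ⊙ₗ m ⟶ m) :
    (actionMonad M A.pt).η.app m ≫ ξ = 𝟙 m ↔ coactionHom A.cowedge ξ (𝟙_ C) = 𝟙 _ := by
  have h : coactionHom A.cowedge ξ (𝟙_ C) = A.monObj.one ⊵ₗ m ≫ ξ ≫ (λₗ[C] m).inv := by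
    rw [coactionHom, A.coaction_unit, ← actionUnitIso_inv_naturality, actionUnitIso_action_inv]
    simp only [comp_actionHomLeft, Category.assoc]
  rw [h, ← Category.assoc, Iso.comp_inv_eq, Category.id_comp]
  change ((λₗ[C] m).inv ≫ A.monObj.one ⊵ₗ m) ≫ ξ = 𝟙 m ↔ _
  rw [Category.assoc, Iso.inv_comp_eq, Category.comp_id]

theorem coactionHom_tensor_of_assoc {m : M} {ξ : A.pt ⊙ₗ m ⟶ m}
    (h : (actionMonad M A.pt).μ.app m ≫ ξ = A.pt ⊴ₗ ξ ≫ ξ) (X Y : C) :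
    coactionHom A.cowedge ξ (X ⊗ Y) = (β_ Y X).inv ⊵ₗ m ≫ (αₗ Y X m).hom ≫
      Y ⊴ₗ coactionHom A.cowedge ξ X ≫ (αₗ Y X m).inv ≫ (β_ Y X).hom ⊵ₗ m ≫ (αₗ X Y m).hom ≫
        X ⊴ₗ coactionHom A.cowedge ξ Y ≫ (αₗ X Y m).inv := by
  have h₁ := A.isMultiplicative.coactionHom_coactionSwap_mul ξ X Y
  have h₂ : (αₗ A.pt A.pt m).inv ≫ A.monObj.mul ⊵ₗ m ≫ ξ = A.pt ⊴ₗ ξ ≫ ξ :=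
    (Category.assoc _ _ _).symm.trans h
  rw [h₂, coactionHom_coactionSwap_actionHomRight, Iso.inv_comp_eq, Iso.hom_inv_id_assoc,
    ← Iso.comp_inv_eq] at h₁
  rw [← h₁]
  simp only [Category.assoc]

/-- The reflection attached to an action of the coend algebra. -/
theorem exists_reflection (k : Type w) [Field k] [Abelian M] [Linear k M] [IsFiniteCategory k M]
    {m : M} {ξ : A.pt ⊙ₗ m ⟶ m} (unit : (actionMonad M A.pt).η.app m ≫ ξ = 𝟙 m)
    (assoc : (actionMonad M A.pt).μ.app m ≫ ξ = A.pt ⊴ₗ ξ ≫ ξ) :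
    ∃ r : Reflection C m, ∀ X, (r.e X).hom = coactionHom A.cowedge ξ X := by
  have hiso (X : C) : IsIso (coactionHom A.cowedge ξ X) := by
    obtain ⟨g, hg⟩ := exists_comp_eq_id (coactionHom A.cowedge ξ)
      (coactionHom_naturality A.cowedge ξ) (A.coactionHom_tensor_of_assoc assoc)
      ((A.unit_iff ξ).1 unit) X
    have := IsFiniteCategory.finiteDimensional_hom (k := k) (X ⊙ₗ m) (X ⊙ₗ m)
    exact isIso_of_comp_eq_id k hg
  exact ⟨{
    e := fun X => asIso (coactionHom A.cowedge ξ X)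
    naturality := coactionHom_naturality A.cowedge ξ
    tensor := A.coactionHom_tensor_of_assoc assoc }, fun X => rfl⟩

variable [Abelian C] [MonoidalPreadditive C] [Abelian M] [IsRightExactAction C M]

/-- Testing by the coactions on `Y` and then `X` turns the two sides of associativity into the two
sides of the tensor axiom. -/
theorem assoc_of_coactionHom_tensor (k : Type w) [Field k] [Linear k C] [IsFiniteCategory k C]
    {m : M} {ξ : A.pt ⊙ₗ m ⟶ m}
    (h : ∀ X Y : C, coactionHom A.cowedge ξ (X ⊗ Y) = (β_ Y X).inv ⊵ₗ m ≫ (αₗ Y X m).hom ≫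
      Y ⊴ₗ coactionHom A.cowedge ξ X ≫ (αₗ Y X m).inv ≫ (β_ Y X).hom ⊵ₗ m ≫ (αₗ X Y m).hom ≫
        X ⊴ₗ coactionHom A.cowedge ξ Y ≫ (αₗ X Y m).inv) :
    (actionMonad M A.pt).μ.app m ≫ ξ = A.pt ⊴ₗ ξ ≫ ξ := by
  refine (Category.assoc (αₗ A.pt A.pt m).inv _ _).trans ?_
  refine coactionHom_injective k A.isColimit fun Y => ?_
  rw [← cancel_epi (αₗ Y A.pt m).hom, ← cancel_epi ((β_ Y A.pt).inv ⊵ₗ m),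
    ← cancel_epi (αₗ A.pt Y m).inv]
  refine coactionHom_injective k A.isColimit fun X => ?_
  refine (A.isMultiplicative.coactionHom_coactionSwap_mul ξ X Y).trans
    (Eq.trans ?_ (coactionHom_coactionSwap_actionHomRight A.cowedge ξ ξ X Y).symm)
  rw [h]
  simp only [Category.assoc, Iso.inv_hom_id, Category.comp_id]

/-- The action of the coend algebra attached to a reflection exists and is unique. -/
theorem exists_isInducedAction_iff (k : Type w) [Field k] [Linear k C] [MonoidalLinear k C]
    [IsFiniteCategory k C] {m : M} (r : Reflection C m) :
    ∃ ξ : A.pt ⊙ₗ m ⟶ m, ∀ ζ, IsInducedAction A r ζ ↔ ζ = ξ := by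
  obtain ⟨ξ, hξ⟩ := exists_coactionHom_eq k A.isColimit (fun X => (r.e X).hom)
    fun X Y u => r.naturality u
  refine ⟨ξ, fun ζ => ⟨fun h => ?_, fun h => h ▸ (A.isInducedAction_iff r ξ).2 hξ⟩⟩
  exact coactionHom_injective k A.isColimit fun X =>
    ((A.isInducedAction_iff r ζ).1 h X).trans (hξ X).symm

end CoendAlgebra

end ReflectiveEM

end

/-! ### The equivalence -/

theorem proposition3 (k : Type*) [Field k] [IsAlgClosed k]
    (C : Type*) [Category* C] [Abelian C] [Linear k C] [MonoidalCategory C]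
    [MonoidalPreadditive C] [MonoidalLinear k C] [RigidCategory C] [BraidedCategory C]
    [IsFiniteTensorCategory k C]
    (M : Type*) [Category* M] [Abelian M] [Linear k M] [MonoidalLeftAction C M]
    [IsFiniteModuleCategory k C M] :
    Nonempty (CoendAlgebra C) ∧
    ∀ A : CoendAlgebra C,
      ∃ (ξ : ∀ E : ReflectiveCenter C M, A.pt ⊙ₗ E.obj ⟶ E.obj)
        (_ : ∀ (E : ReflectiveCenter C M) (ζ : A.pt ⊙ₗ E.obj ⟶ E.obj),
          IsInducedAction A E.refl ζ ↔ ζ = ξ E)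
        (unit : ∀ E, (actionMonad M A.pt).η.app E.obj ≫ ξ E = 𝟙 E.obj)
        (assoc : ∀ E, (actionMonad M A.pt).μ.app E.obj ≫ ξ E = (A.pt ⊴ₗ ξ E) ≫ ξ E)
        (linear : ∀ {E E' : ReflectiveCenter C M} (f : E ⟶ E'),
          A.pt ⊴ₗ f.hom ≫ ξ E' = ξ E ≫ f.hom)
        (e : ∀ N : (actionMonad M A.pt).Algebra, Reflection C N.A)
        (_ : ∀ (N : (actionMonad M A.pt).Algebra) (X : C),
          ((e N).e X).hom = inducedReflection A N.a X)
        (comm : ∀ {N N' : (actionMonad M A.pt).Algebra} (g : N ⟶ N') (X : C),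
          ((e N).e X).hom ≫ X ⊴ₗ g.f = X ⊴ₗ g.f ≫ ((e N').e X).hom)
        (Φ : ReflectiveCenter C M ≌ (actionMonad M A.pt).Algebra),
        Φ.functor = liftEM (ReflectiveCenter.forget C M) (actionMonad M A.pt) ξ
          unit assoc linear ∧
        Φ.inverse = ReflectiveCenter.lift (actionMonad M A.pt).forget e comm := by
  have hM : IsRightExactAction C M := IsFiniteModuleCategory.isRightExactAction k
  refine ⟨exists_coendAlgebra k, fun A => ?_⟩
  choose ξ hξ using fun E : ReflectiveCenter C M => A.exists_isInducedAction_iff k E.refl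
  have hξe (E : ReflectiveCenter C M) (X : C) :
      coactionHom A.cowedge (ξ E) X = (E.refl.e X).hom :=
    (A.isInducedAction_iff E.refl (ξ E)).1 ((hξ E (ξ E)).2 rfl) X
  choose e he using fun N : (actionMonad M A.pt).Algebra =>
    A.exists_reflection k N.unit N.assoc
  have unit (E) : (actionMonad M A.pt).η.app E.obj ≫ ξ E = 𝟙 E.obj :=
    (A.unit_iff (ξ E)).2 ((hξe E _).trans E.refl.e_unit)
  have assoc (E) : (actionMonad M A.pt).μ.app E.obj ≫ ξ E = (A.pt ⊴ₗ ξ E) ≫ ξ E :=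
    A.assoc_of_coactionHom_tensor k fun X Y => by
      simp only [hξe]
      exact E.refl.tensor X Y
  have linear {E E' : ReflectiveCenter C M} (f : E ⟶ E') :
      A.pt ⊴ₗ f.hom ≫ ξ E' = ξ E ≫ f.hom :=
    coactionHom_injective k A.isColimit fun X => by
      rw [comp_coactionHom, coactionHom_comp, hξe, hξe]
      exact (f.comm X).symm
  have comm {N N' : (actionMonad M A.pt).Algebra} (g : N ⟶ N') (X : C) :
      ((e N).e X).hom ≫ X ⊴ₗ g.f = X ⊴ₗ g.f ≫ ((e N').e X).hom := by
    rw [he, he]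
    exact (coactionHom_comp A.cowedge N.a g.f X).symm.trans
      ((congrArg (coactionHom A.cowedge · X) g.h.symm).trans
        (comp_coactionHom A.cowedge g.f N'.a X))
  let H := liftEM (ReflectiveCenter.forget C M) (actionMonad M A.pt) ξ unit assoc linear
  let H' := ReflectiveCenter.lift (actionMonad M A.pt).forget e comm
  have hHe (E : ReflectiveCenter C M) (X : C) : ((e (H.obj E)).e X).hom = (E.refl.e X).hom :=
    (he _ X).trans (hξe E X)
  -- Both actions have the same natural family, so both round trips fix the structure, and
  -- identities of underlying objects serve as unit and counit.
  have hHa (N : (actionMonad M A.pt).Algebra) : ξ (H'.obj N) = N.a :=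
    coactionHom_injective k A.isColimit fun X => (hξe _ X).trans (he N X)
  let ε₁ : 𝟭 (ReflectiveCenter C M) ≅ H ⋙ H' := NatIso.ofComponents
    (fun E => ReflectiveCenter.isoOfEq E.refl (e (H.obj E)) fun X => (hHe E X).symm)
    fun f => ReflectiveCenter.Hom.ext ((Category.comp_id _).trans (Category.id_comp _).symm)
  let ε₂ : H' ⋙ H ≅ 𝟭 (actionMonad M A.pt).Algebra := NatIso.ofComponents
    (fun N => Monad.Algebra.isoMk (Iso.refl N.A) (by
      change (actionMonad M A.pt).map (𝟙 N.A) ≫ N.a = ξ (H'.obj N) ≫ 𝟙 N.A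
      rw [hHa, (actionMonad M A.pt).map_id]
      exact (Category.id_comp _).trans (Category.comp_id _).symm))
    fun f => Monad.Algebra.Hom.ext ((Category.comp_id _).trans (Category.id_comp _).symm)
  exact ⟨ξ, hξ, unit, assoc, linear, e,
    fun N X => (he N X).trans (A.inducedReflection_eq N.a X).symm, comm,
    CategoryTheory.Equivalence.mk H H' ε₁ ε₂, rfl, rfl⟩
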